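/- Let $m>0$ and let $A=(A_1,A_2,A_3):\mathbb R^3\to\mathbb R^3$, where each $A_j$ is a real-valued continuous function with $A_j(x)=o(|x|^{-1})$ as $|x|\to\infty$. Let $$\alpha_j=\begin{pmatrix}0&\sigma_j\\ \sigma_j&0\end{pmatrix}\ (j=1,2,3),\qquad \beta=\begin{pmatrix}I_2&0\\0&-I_2\end{pmatrix},$$ with the Pauli matrices $\sigma_1=\begin{pmatrix}0&1\\1&0\end{pmatrix}$, $\sigma_2=\begin{pmatrix}0&-i\\i&0\end{pmatrix}$, $\sigma_3=\begin{pmatrix}1&0\\0&-1\end{pmatrix}$, and let $$H_A=\alpha\cdot(D-A(x))+m\beta,\qquad D=\tfrac1i\nabla_x,$$ be the magnetic Dirac operator in the Hilbert space $[L^2(\mathbb R^3)]^4$, defined as the operator sum of $H_0=\alpha\cdot D+m\beta$ with domain $[H^1(\mathbb R^3)]^4$ and of the operator of multiplication by the bounded matrix-valued function $-\alpha\cdot A(x)$; thus $\mathrm{Dom}(H_A)=[H^1(\mathbb R^3)]^4$. Then $$\sigma(H_A)=\sigma_{\mathrm{ess}}(H_A)=(-\infty,-m]\cup[m,\infty),$$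 where $\sigma(H_A)\subset\mathbb C$ is the spectrum of $H_A$ and $\sigma_{\mathrm{ess}}(H_A)$ is the essential spectrum, i.e. the set of points of $\sigma(H_A)$ that are not isolated points of $\sigma(H_A)$ which are eigenvalues of finite multiplicity. -/

import Mathlib

open MeasureTheory Asymptotics Filter
open scoped SchwartzMap LineDeriv

/-! ### Spectra of unbounded operators -/

namespace LinearPMap

variable {E : Type*} [NormedAddCommGroup E] [NormedSpace ℂ E]

/-- The resolvent set of an unbounded operator `T`: those `z` for which `T - z`, defined on the
domain of `T`, is a bijection onto the whole space with a bounded inverse `R`. -/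
def resolventSet (T : E →ₗ.[ℂ] E) : Set ℂ :=
  {z | ∃ R : E →L[ℂ] E,
    (∀ y : E, ∃ h : R y ∈ T.domain, T ⟨R y, h⟩ - z • R y = y) ∧
    ∀ x : T.domain, R (T x - z • (x : E)) = (x : E)}

/-- The spectrum of an unbounded operator. -/
def spectrum (T : E →ₗ.[ℂ] E) : Set ℂ := (resolventSet T)ᶜ

/-- The eigenspace `Ker (T - z)` of an unbounded operator. -/
def eigenspace (T : E →ₗ.[ℂ] E) (z : ℂ) : Submodule ℂ E :=
  (LinearMap.ker (T.toFun - z • T.domain.subtype)).map T.domain.subtype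

/-- The discrete spectrum: the isolated points of the spectrum that are eigenvalues of finite
multiplicity. -/
def discreteSpectrum (T : E →ₗ.[ℂ] E) : Set ℂ :=
  {z ∈ spectrum T | (∃ ε > 0, ∀ w ∈ spectrum T, dist w z < ε → w = z) ∧
    eigenspace T z ≠ ⊥ ∧ FiniteDimensional ℂ (eigenspace T z)}

/-- The essential spectrum of a self-adjoint operator: the complement of the discrete spectrum in
the spectrum. -/
def essentialSpectrum (T : E →ₗ.[ℂ] E) : Set ℂ := spectrum T \ discreteSpectrum T

end LinearPMap

/-! ### The magnetic Dirac operator -/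

namespace MagneticDirac

noncomputable section

/-- Physical space `ℝ³` with the Euclidean norm. -/
abbrev Space : Type := EuclideanSpace ℝ (Fin 3)

/-- The space `ℂ⁴ = ℂ² ⊕ ℂ²` of spinors, with its standard Hermitian norm. -/
abbrev Spinor : Type := EuclideanSpace ℂ (Fin 2 ⊕ Fin 2)

/-- The Hilbert space `[L²(ℝ³)]⁴`. -/
abbrev SpinorL2 : Type := Lp Spinor 2 (volume : Measure Space)

/-- The Pauli matrices `σ₁, σ₂, σ₃`. -/
def pauli : Fin 3 → Matrix (Fin 2) (Fin 2) ℂ :=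
  ![!![0, 1; 1, 0], !![0, -Complex.I; Complex.I, 0], !![1, 0; 0, -1]]

/-- The Dirac matrices `α₁, α₂, α₃`. -/
def alpha (j : Fin 3) : Matrix (Fin 2 ⊕ Fin 2) (Fin 2 ⊕ Fin 2) ℂ :=
  Matrix.fromBlocks 0 (pauli j) (pauli j) 0

/-- The Dirac matrix `β`. -/
def beta : Matrix (Fin 2 ⊕ Fin 2) (Fin 2 ⊕ Fin 2) ℂ :=
  Matrix.fromBlocks 1 0 0 (-1)

/-- Pointwise application of a constant matrix to an `L²` spinor field. -/
def matrixL2 (M : Matrix (Fin 2 ⊕ Fin 2) (Fin 2 ⊕ Fin 2) ℂ) : SpinorL2 →L[ℂ] SpinorL2 :=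
  (Matrix.toEuclideanCLM (𝕜 := ℂ) M).compLpL 2 volume

/-- The Sobolev space `[H¹(ℝ³)]⁴` as a subspace of `[L²(ℝ³)]⁴`. -/
def sobolevH1 : Submodule ℂ SpinorL2 where
  carrier := {u | TemperedDistribution.MemSobolev 1 2 (u : 𝓢'(Space, Spinor))}
  add_mem' {u v} hu hv := by
    have h := TemperedDistribution.MemSobolev.add hu hv
    simp only [← Lp.toTemperedDistributionCLM_apply, ← map_add] at h
    exact h
  zero_mem' := by
    have h := TemperedDistribution.memSobolev_fun_zero Space Spinor 1 2
    rw [← map_zero (Lp.toTemperedDistributionCLM Spinor (volume : Measure Space) 2)] at h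
    exact h
  smul_mem' c u hu := by
    have h := TemperedDistribution.MemSobolev.smul c hu
    simp only [← Lp.toTemperedDistributionCLM_apply, ← map_smul] at h
    exact h

theorem toTemperedDistributionCLM_injective :
    Function.Injective (Lp.toTemperedDistributionCLM Spinor (volume : Measure Space) 2) :=
  LinearMap.ker_eq_bot.mp (Lp.ker_toTemperedDistributionCLM_eq_bot (F := Spinor)
    (μ := (volume : Measure Space)) (p := 2))

theorem exists_weakDeriv (j : Fin 3) (u : sobolevH1) :
    ∃ v : SpinorL2, ∂_{EuclideanSpace.single j (1 : ℝ)} ((u : SpinorL2) : 𝓢'(Space, Spinor)) =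
      (v : 𝓢'(Space, Spinor)) := by
  have h := TemperedDistribution.MemSobolev.lineDerivOp u.2
    (m := (EuclideanSpace.single j (1 : ℝ) : Space))
  rw [sub_self] at h
  exact TemperedDistribution.memSobolev_zero_iff.mp h

/-- The distributional partial derivative `∂ⱼ : [H¹]⁴ → [L²]⁴`. -/
def weakDeriv (j : Fin 3) : sobolevH1 →ₗ[ℂ] SpinorL2 where
  toFun u := (exists_weakDeriv j u).choose
  map_add' u v := by
    apply toTemperedDistributionCLM_injective
    simp only [map_add, Lp.toTemperedDistributionCLM_apply]
    rw [← (exists_weakDeriv j (u + v)).choose_spec, ← (exists_weakDeriv j u).choose_spec,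
      ← (exists_weakDeriv j v).choose_spec, ← LineDeriv.lineDerivOp_add]
    simp only [Submodule.coe_add, ← Lp.toTemperedDistributionCLM_apply, map_add]
  map_smul' c u := by
    apply toTemperedDistributionCLM_injective
    simp only [map_smul, RingHom.id_apply, Lp.toTemperedDistributionCLM_apply]
    rw [← (exists_weakDeriv j (c • u)).choose_spec, ← (exists_weakDeriv j u).choose_spec,
      ← LineDeriv.lineDerivOp_smul]
    simp only [Submodule.coe_smul, ← Lp.toTemperedDistributionCLM_apply, map_smul]

/-- The free Dirac operator `H₀ = α · D + m β`, `D = -i ∇`, with domain `[H¹(ℝ³)]⁴`. -/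
def freeDirac (m : ℝ) : SpinorL2 →ₗ.[ℂ] SpinorL2 where
  domain := sobolevH1
  toFun := ∑ j : Fin 3, (-Complex.I) • ((matrixL2 (alpha j)).toLinearMap ∘ₗ weakDeriv j) +
    (m : ℂ) • ((matrixL2 beta).toLinearMap ∘ₗ sobolevH1.subtype)

/-- The matrix `α · A(x)`. -/
def alphaDot (A : Space → Space) (x : Space) : Matrix (Fin 2 ⊕ Fin 2) (Fin 2 ⊕ Fin 2) ℂ :=
  ∑ j : Fin 3, (A x j : ℂ) • alpha j

/-- The pointwise defined spinor field `x ↦ α · A(x) u(x)`. -/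
def alphaDotMul (A : Space → Space) (u : Space → Spinor) (x : Space) : Spinor :=
  Matrix.toEuclideanCLM (𝕜 := ℂ) (alphaDot A x) (u x)

theorem alphaDotMul_add (A : Space → Space) (u v : SpinorL2) :
    alphaDotMul A (u + v : SpinorL2) =ᵐ[volume] alphaDotMul A u + alphaDotMul A v := by
  filter_upwards [Lp.coeFn_add u v] with x hx
  rw [Pi.add_apply, alphaDotMul, alphaDotMul, alphaDotMul, hx, Pi.add_apply, map_add]

theorem alphaDotMul_smul (A : Space → Space) (c : ℂ) (u : SpinorL2) :
    alphaDotMul A (c • u : SpinorL2) =ᵐ[volume] c • alphaDotMul A u := by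
  filter_upwards [Lp.coeFn_smul c u] with x hx
  rw [Pi.smul_apply, alphaDotMul, alphaDotMul, hx, Pi.smul_apply, map_smul]

theorem alphaDotMul_zero (A : Space → Space) :
    alphaDotMul A (0 : SpinorL2) =ᵐ[volume] 0 := by
  filter_upwards [Lp.coeFn_zero Spinor 2 (volume : Measure Space)] with x hx
  rw [alphaDotMul, hx, Pi.zero_apply, map_zero]

/-- The maximal domain of multiplication by `α · A`: all `u ∈ [L²]⁴` with `(α · A) u ∈ [L²]⁴`. -/
def magneticDomain (A : Space → Space) : Submodule ℂ SpinorL2 where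
  carrier := {u | MemLp (alphaDotMul A u) 2 volume}
  add_mem' {u v} hu hv := (memLp_congr_ae (alphaDotMul_add A u v)).mpr (hu.add hv)
  zero_mem' := (memLp_congr_ae (alphaDotMul_zero A)).mpr MemLp.zero
  smul_mem' c u hu := (memLp_congr_ae (alphaDotMul_smul A c u)).mpr (hu.const_smul c)

/-- Multiplication by `α · A` in `[L²(ℝ³)]⁴`, with its maximal domain
(which is all of `[L²(ℝ³)]⁴` when `A` is measurable and bounded). -/
def magneticTerm (A : Space → Space) : SpinorL2 →ₗ.[ℂ] SpinorL2 where
  domain := magneticDomain A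
  toFun :=
    { toFun := fun u ↦ MemLp.toLp (alphaDotMul A (u : SpinorL2)) u.2
      map_add' := fun u v ↦
        (MemLp.toLp_congr _ (u.2.add v.2) (alphaDotMul_add A u v)).trans
          (MemLp.toLp_add u.2 v.2)
      map_smul' := fun c u ↦
        (MemLp.toLp_congr _ (u.2.const_smul c) (alphaDotMul_smul A c u)).trans
          (MemLp.toLp_const_smul c u.2) }

/-- The magnetic Dirac operator `H_A = α · (D - A) + m β`, as the operator sum of the free Dirac
operator `H₀` and of `-α · A`. -/
def diracOperator (m : ℝ) (A : Space → Space) : SpinorL2 →ₗ.[ℂ] SpinorL2 :=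
  freeDirac m - magneticTerm A

end

end MagneticDirac

/-! Gap: write `H_A = D_A + mβ` with `D_A = α·(D - A)`. Since `β` is Hermitian, squares to `1` and
anticommutes with the symmetric operator `D_A`, the cross term drops out: `‖H_A u‖² = ‖D_A u‖² +
m²‖u‖²` (`sq_le_norm_massiveDirac_sq`). With symmetry this gives `‖(H_A - iη)u‖ ≥ √(m² + η²) ‖u‖`.
Once `H_A - iη` is invertible for large `|η|` of both signs, a Neumann series reaches every `z`
outside the two half-lines (`hasBoundedInverse_of_gap`).

Invertibility comes from the free operator: `(α·D)² = -Δ`, so `(α·D - is)(α·D + is) = -Δ + s²`,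
inverted by a Bessel potential when `s = ±2π` (`alphaD_sub_surjective`). Neumann series then push
`s` up the imaginary axis until `|s|` exceeds the norm of the bounded perturbation `mβ - α·A`.

Conversely, each real `l` with `l² ≥ m²` is an eigenvalue of some symbol `κα₃ + mβ`. A plane wave
with this eigenvector, cut off on a large ball far out where `A` is small, is an approximate
eigenfunction (`exists_approx_eigenfunction`). The resulting spectrum has no isolated points, so it
is all essential. -/

/-! ### Bounded invertibility of symmetric operators with a gap. -/

namespace Submodule

open scoped ComplexInnerProductSpace

variable {E : Type*} [NormedAddCommGroup E]

section NormedSpace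

variable [NormedSpace ℂ E] {D : Submodule ℂ E}

/-- An unbounded operator with domain `D` has a bounded two-sided inverse. -/
def HasBoundedInverse (T : D →ₗ[ℂ] E) : Prop :=
  ∃ R : E →L[ℂ] E, (∀ y : E, ∃ h : R y ∈ D, T ⟨R y, h⟩ = y) ∧ ∀ x : D, R (T x) = x

/-- The lower bound yields both injectivity and the bound `c⁻¹` for the inverse. -/
theorem HasBoundedInverse.of_surjective {T : D →ₗ[ℂ] E} {c : ℝ} (hc : 0 < c)
    (hT : ∀ x : D, c * ‖(x : E)‖ ≤ ‖T x‖) (hs : Function.Surjective T) :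
    HasBoundedInverse T := by
  have hinj : Function.Injective T := by
    rw [injective_iff_map_eq_zero]
    intro x hx
    have h := hT x
    rw [hx, norm_zero] at h
    have : ‖(x : E)‖ ≤ 0 := by
      by_contra! h'
      exact absurd h (not_le.mpr (mul_pos hc h'))
    exact Subtype.ext (norm_le_zero_iff.mp this)
  let e := LinearEquiv.ofBijective T ⟨hinj, hs⟩
  have he : ∀ y, T (e.symm y) = y := fun y ↦ e.apply_symm_apply y
  refine ⟨(D.subtype ∘ₗ e.symm.toLinearMap).mkContinuous c⁻¹ fun y ↦ ?_, fun y ↦ ⟨?_, ?_⟩,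
    fun x ↦ ?_⟩
  · have h := hT (e.symm y)
    rw [he] at h
    rw [inv_mul_eq_div, le_div_iff₀ hc, mul_comm]
    exact h
  · exact (e.symm y).2
  · exact he y
  · exact congrArg Subtype.val (e.symm_apply_apply x)

/-- Bounded invertibility is stable under perturbations smaller than the lower bound. -/
theorem HasBoundedInverse.add_bounded [CompleteSpace E] {T : D →ₗ[ℂ] E}
    (hT : HasBoundedInverse T) {c : ℝ} (hc : ∀ x : D, c * ‖(x : E)‖ ≤ ‖T x‖) {B : E →L[ℂ] E}
    (hB : ‖B‖ < c) : HasBoundedInverse (T + B.toLinearMap ∘ₗ D.subtype) := by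
  obtain ⟨R, h1, h2⟩ := hT
  have hc0 : 0 < c := (norm_nonneg B).trans_lt hB
  have hR : ‖R‖ ≤ c⁻¹ := R.opNorm_le_bound (by positivity) fun y ↦ by
    obtain ⟨hy, hy'⟩ := h1 y
    have h := hc ⟨R y, hy⟩
    rw [hy'] at h
    rw [inv_mul_eq_div, le_div_iff₀ hc0, mul_comm]
    exact h
  have hBR : ‖-(B * R)‖ < 1 := by
    rw [norm_neg]
    calc ‖B * R‖ ≤ ‖B‖ * ‖R‖ := norm_mul_le _ _
      _ ≤ ‖B‖ * c⁻¹ := by gcongr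
      _ < 1 := by rwa [← div_eq_mul_inv, div_lt_one hc0]
  -- Neumann series: on `D`, `T + B = (1 + BR)T` with `‖BR‖ < 1`, so the inverse is `R(1 + BR)⁻¹`.
  let u := Units.oneSub _ hBR
  have hu : ∀ y, (u : E →L[ℂ] E) y = y + B (R y) := fun y ↦ by
    simp [u, Units.val_oneSub]
  set v : E →L[ℂ] E := ((u⁻¹ : (E →L[ℂ] E)ˣ) : E →L[ℂ] E) with hv
  have hu1 : ∀ y, (u : E →L[ℂ] E) (v y) = y := fun y ↦ by
    rw [← mul_apply_eq_comp, hv, Units.mul_inv, one_apply_eq_self]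
  have hu2 : ∀ y, v ((u : E →L[ℂ] E) y) = y := fun y ↦ by
    rw [← mul_apply_eq_comp, hv, Units.inv_mul, one_apply_eq_self]
  refine ⟨R * v, fun y ↦ ?_, fun x ↦ ?_⟩
  · obtain ⟨hy, hy'⟩ := h1 (v y)
    refine ⟨hy, ?_⟩
    have := hu1 y
    rw [hu] at this
    simp only [LinearMap.add_apply, LinearMap.comp_apply]
    refine Eq.trans ?_ this
    congr 1
  · have hx : (T + B.toLinearMap ∘ₗ D.subtype) x = (u : E →L[ℂ] E) (T x) := by
      rw [hu, h2]; rfl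
    rw [hx, mul_apply_eq_comp, hu2, h2]

end NormedSpace

variable [InnerProductSpace ℂ E] {D : Submodule ℂ E}

/-- Symmetry makes `⟪T x, x⟫` real, so the cross term with `iη` has real part zero. -/
theorem norm_sub_I_smul_sq {T : D →ₗ[ℂ] E} (hT : ∀ x y : D, ⟪T x, (y : E)⟫ = ⟪(x : E), T y⟫)
    (η : ℝ) (x : D) :
    ‖T x - (η * Complex.I) • (x : E)‖ ^ 2 = ‖T x‖ ^ 2 + η ^ 2 * ‖(x : E)‖ ^ 2 := by
  have him : (⟪T x, (x : E)⟫).im = 0 := by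
    have h := inner_conj_symm (𝕜 := ℂ) (T x) (x : E)
    rw [← hT x x] at h
    have := congrArg Complex.im h
    simp only [Complex.conj_im] at this
    linarith
  rw [norm_sub_sq (𝕜 := ℂ), inner_smul_right, norm_smul]
  simp [him, mul_pow]

theorem le_norm_sub_I_smul {T : D →ₗ[ℂ] E}
    (hT : ∀ x y : D, ⟪T x, (y : E)⟫ = ⟪(x : E), T y⟫) {m : ℝ}
    (hm : ∀ x : D, m ^ 2 * ‖(x : E)‖ ^ 2 ≤ ‖T x‖ ^ 2) (η : ℝ) (x : D) :
    √(m ^ 2 + η ^ 2) * ‖(x : E)‖ ≤ ‖(T - (η * Complex.I) • D.subtype) x‖ := by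
  apply le_of_sq_le_sq _ (norm_nonneg _)
  have h := norm_sub_I_smul_sq hT η x
  simp only [LinearMap.sub_apply, LinearMap.smul_apply, Submodule.subtype_apply]
  rw [h, mul_pow, Real.sq_sqrt (by positivity), add_mul]
  linarith [hm x]

/-- If `T` is symmetric and `T - i s` is onto for some real `s ≠ 0`, then `T - i s (3 / 2) ^ n` is
boundedly invertible for all `n`. -/
theorem hasBoundedInverse_sub_I_smul_pow [CompleteSpace E] {T : D →ₗ[ℂ] E}
    (hT : ∀ x y : D, ⟪T x, (y : E)⟫ = ⟪(x : E), T y⟫) {s : ℝ} (hs : s ≠ 0)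
    (hsurj : Function.Surjective (T - (s * Complex.I) • D.subtype)) (n : ℕ) :
    HasBoundedInverse (T - ((s * (3 / 2) ^ n : ℝ) * Complex.I) • D.subtype) := by
  have hlow : ∀ (η : ℝ) (x : D),
      |η| * ‖(x : E)‖ ≤ ‖(T - (η * Complex.I) • D.subtype) x‖ := fun η x ↦ by
    have := le_norm_sub_I_smul hT (m := 0) (fun x ↦ by simp) η x
    simpa [Real.sqrt_sq_eq_abs] using this
  induction n with
  | zero => simpa using HasBoundedInverse.of_surjective (abs_pos.mpr hs) (hlow s) hsurj
  | succ n ih =>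
    have hpos : 0 < |s * (3 / 2) ^ n| := by positivity
    -- Going from `η` to `3η/2` is a perturbation of norm `|η|/2`, below the lower bound `|η|`; any
    -- factor in `(1, 2)` would serve.
    have h := ih.add_bounded (hlow _)
      (B := (-(((s * (3 / 2) ^ n / 2 : ℝ)) * Complex.I)) • ContinuousLinearMap.id ℂ E) ?_
    · convert h using 1
      ext x
      simp only [LinearMap.sub_apply, LinearMap.smul_apply, Submodule.subtype_apply,
        LinearMap.add_apply, LinearMap.comp_apply, ContinuousLinearMap.coe_coe,
        _root_.smul_apply, ContinuousLinearMap.id_apply]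
      rw [sub_add, ← sub_smul]
      congr 2
      push_cast
      ring
    · calc _ ≤ ‖-(((s * (3 / 2) ^ n / 2 : ℝ)) * Complex.I)‖ * 1 := by
            rw [norm_smul]; gcongr; exact ContinuousLinearMap.norm_id_le
        _ = |s * (3 / 2) ^ n| / 2 := by
            rw [norm_neg, norm_mul, Complex.norm_I, Complex.norm_real, Real.norm_eq_abs, abs_div]
            simp
        _ < _ := by linarith

/-- A symmetric operator `T` with spectral gap `(-m, m)` such that `T - i η` is boundedly
invertible for arbitrarily large `η` of both signs has its spectrum in
`(-∞, -m] ∪ [m, ∞)`. -/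
theorem hasBoundedInverse_of_gap [CompleteSpace E] {T : D →ₗ[ℂ] E}
    (hT : ∀ x y : D, ⟪T x, (y : E)⟫ = ⟪(x : E), T y⟫) {m : ℝ}
    (hm : ∀ x : D, m ^ 2 * ‖(x : E)‖ ^ 2 ≤ ‖T x‖ ^ 2)
    (hpos : ∀ C : ℝ, ∃ η ≥ C, HasBoundedInverse (T - (η * Complex.I) • D.subtype))
    (hneg : ∀ C : ℝ, ∃ η ≤ C, HasBoundedInverse (T - (η * Complex.I) • D.subtype))
    {z : ℂ} (hz : z.im = 0 → |z.re| < m) : HasBoundedInverse (T - z • D.subtype) := by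
  -- The condition says `|z - iη|² < m² + η²`, i.e. `|z|² < m² + 2η Im z`. For `Im z ≠ 0` a large
  -- `η` of the same sign works, and `C` is chosen so that `2η Im z ≥ |z|² + 1`; for real `z` any
  -- `η` works.
  obtain ⟨η, hη, hinv⟩ : ∃ η : ℝ, z.re ^ 2 + (η - z.im) ^ 2 < m ^ 2 + η ^ 2 ∧
      HasBoundedInverse (T - (η * Complex.I) • D.subtype) := by
    set C := (z.re ^ 2 + z.im ^ 2 + 1) / (2 * z.im) with hC
    rcases lt_trichotomy z.im 0 with h | h | h
    · obtain ⟨η, hη, hinv⟩ := hneg C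
      refine ⟨η, ?_, hinv⟩
      rw [hC, le_div_iff_of_neg (by linarith)] at hη
      nlinarith [sq_nonneg m]
    · obtain ⟨η, -, hinv⟩ := hpos 0
      refine ⟨η, ?_, hinv⟩
      have := sq_lt_sq' (abs_lt.mp (hz h)).1 (abs_lt.mp (hz h)).2
      rw [h]
      linarith
    · obtain ⟨η, hη, hinv⟩ := hpos C
      refine ⟨η, ?_, hinv⟩
      rw [hC, ge_iff_le, div_le_iff₀ (by linarith)] at hη
      nlinarith [sq_nonneg m]
  have h := hinv.add_bounded (le_norm_sub_I_smul hT hm η)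
    (B := (η * Complex.I - z) • ContinuousLinearMap.id ℂ E) ?_
  · convert h using 1
    ext x
    simp only [LinearMap.sub_apply, LinearMap.smul_apply, Submodule.subtype_apply,
      LinearMap.add_apply, LinearMap.comp_apply, ContinuousLinearMap.coe_coe,
      _root_.smul_apply, ContinuousLinearMap.id_apply]
    rw [sub_smul]
    abel
  · calc _ ≤ ‖η * Complex.I - z‖ * 1 := by
          rw [norm_smul]; gcongr; exact ContinuousLinearMap.norm_id_le
      _ < _ := by
          rw [mul_one, Complex.norm_def]
          apply Real.sqrt_lt_sqrt (Complex.normSq_nonneg _)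
          rw [Complex.normSq_apply]
          simp
          nlinarith

end Submodule

/-! ### Approximate eigenvectors and isolated points. -/

namespace LinearPMap

variable {E : Type*} [NormedAddCommGroup E] [NormedSpace ℂ E]

/-- A bounded left inverse `R` of `T - z` would force `‖x‖ ≤ ε‖R‖‖x‖`, absurd once `ε‖R‖ < 1`. -/
theorem notMem_resolventSet_of_approx {T : E →ₗ.[ℂ] E} {z : ℂ}
    (h : ∀ ε > 0, ∃ x : T.domain, (x : E) ≠ 0 ∧ ‖T x - z • (x : E)‖ ≤ ε * ‖(x : E)‖) :
    z ∉ resolventSet T := by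
  rintro ⟨R, -, hR⟩
  obtain ⟨x, hx0, hx⟩ := h (2 * (‖R‖ + 1))⁻¹ (by positivity)
  have h1 : ‖(x : E)‖ ≤ ‖R‖ * ((2 * (‖R‖ + 1))⁻¹ * ‖(x : E)‖) := by
    calc ‖(x : E)‖ = ‖R (T x - z • (x : E))‖ := by rw [hR]
      _ ≤ ‖R‖ * ‖T x - z • (x : E)‖ := R.le_opNorm _
      _ ≤ _ := by gcongr
  have h2 : 0 < ‖(x : E)‖ := norm_pos_iff.mpr hx0
  have h3 : ‖R‖ * (2 * (‖R‖ + 1))⁻¹ < 1 := by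
    rw [← div_eq_mul_inv, div_lt_one (by positivity)]
    linarith [norm_nonneg R]
  nlinarith

theorem essentialSpectrum_eq_spectrum_of_no_isolated {T : E →ₗ.[ℂ] E}
    (h : ∀ z ∈ spectrum T, ∀ ε > 0, ∃ w ∈ spectrum T, dist w z < ε ∧ w ≠ z) :
    essentialSpectrum T = spectrum T := by
  refine Disjoint.sdiff_eq_left (Set.disjoint_left.mpr ?_)
  rintro z hz ⟨-, ⟨ε, hε, hiso⟩, -⟩
  obtain ⟨w, hw, hd, hne⟩ := h z hz ε hε
  exact hne (hiso w hw hd)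

end LinearPMap

/-! ### Fourier multipliers on `L²`. -/

namespace TemperedDistribution

open FourierTransform
open scoped ComplexInnerProductSpace ComplexConjugate ContDiff

variable {E F : Type*} [NormedAddCommGroup E] [InnerProductSpace ℝ E] [FiniteDimensional ℝ E]
  [MeasurableSpace E] [BorelSpace E] [NormedAddCommGroup F] [InnerProductSpace ℂ F]

open Laplacian

/-- In this Fourier normalization `Δ` has symbol `-(2π)²|ξ|²`, while the Bessel potential of order
`2` has symbol `1 + |ξ|²`. This is where the special value `s² = (2π)²` comes from. -/
theorem besselPotential_two_eq (f : 𝓢'(E, F)) :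
    (2 * Real.pi) ^ 2 • besselPotential E F 2 f = (2 * Real.pi) ^ 2 • f - Δ f := by
  have h : besselPotential E F 2 f =
      f + fourierMultiplierCLM F (fun x ↦ Complex.ofReal (‖x‖ ^ 2)) f := by
    have hsym : (fun x : E ↦ (((1 + ‖x‖ ^ 2) ^ ((2 : ℝ) / 2) : ℝ) : ℂ)) =
        (fun _ ↦ 1) + fun x ↦ Complex.ofReal (‖x‖ ^ 2) := by
      ext x
      simp
    rw [besselPotential, hsym, fourierMultiplierCLM_apply, smulLeftCLM_add (by fun_prop)
      (by fun_prop), _root_.add_apply, fourierInv_add]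
    simp [fourierMultiplierCLM_apply]
  rw [h, laplacian_eq_fourierMultiplierCLM, smul_add, neg_smul, sub_neg_eq_add]

theorem lineDerivOp_comm (m m' : E) (f : 𝓢'(E, F)) : ∂_{m} (∂_{m'} f) = ∂_{m'} (∂_{m} f) := by
  simp only [lineDeriv_eq_fourierMultiplierCLM, map_smul]
  rw [fourierMultiplierCLM_fourierMultiplierCLM_apply (by fun_prop) (by fun_prop),
    fourierMultiplierCLM_fourierMultiplierCLM_apply (by fun_prop) (by fun_prop),
    mul_comm (fun x ↦ ((inner ℝ x m' : ℝ) : ℂ))]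

variable [CompleteSpace F]

/-- The `L²` function `v` is the image of the `L²` function `u` under the Fourier multiplier with
symbol `g`. -/
def IsFourierMultiplier (g : E → ℂ) (u v : Lp F 2 (volume : Measure E)) : Prop :=
  fourierMultiplierCLM F g (u : 𝓢'(E, F)) = (v : 𝓢'(E, F))

/-- Turns a distributional identity into a pointwise one, so that Plancherel applies. Local
integrability of both sides suffices, by testing against smooth compactly supported functions. -/
theorem IsFourierMultiplier.fourier_ae {g : E → ℂ} (hg : g.HasTemperateGrowth)
    {u v : Lp F 2 (volume : Measure E)} (h : IsFourierMultiplier g u v) :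
    ∀ᵐ x, (𝓕 v : Lp F 2 (volume : Measure E)) x = g x • (𝓕 u : Lp F 2 (volume : Measure E)) x := by
  have hd : smulLeftCLM F g ((𝓕 u : Lp F 2 (volume : Measure E)) : 𝓢'(E, F)) =
      ((𝓕 v : Lp F 2 (volume : Measure E)) : 𝓢'(E, F)) := by
    rw [← Lp.fourier_toTemperedDistribution_eq, ← Lp.fourier_toTemperedDistribution_eq, ← h,
      fourierMultiplierCLM_apply, fourier_fourierInv_eq]
  have hloc : ∀ w : Lp F 2 (volume : Measure E), LocallyIntegrable w := fun w ↦
    (Lp.memLp w).locallyIntegrable (by norm_num)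
  apply ae_eq_of_integral_contDiff_smul_eq (hloc _)
  · exact (hloc (𝓕 u)).continuous_smul hg.1.continuous
  · intro φ hφ hφ'
    have h1 : HasCompactSupport (Complex.ofRealCLM ∘ φ) := hφ'.comp_left rfl
    have h2 : ContDiff ℝ ∞ (Complex.ofRealCLM ∘ φ) := by fun_prop
    have h3 := congrArg (fun T : 𝓢'(E, F) ↦ T (h1.toSchwartzMap h2)) hd
    simp only [smulLeftCLM_apply_apply, Lp.toTemperedDistribution_apply,
      SchwartzMap.smulLeftCLM_apply_apply hg, HasCompactSupport.toSchwartzMap_toFun] at h3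
    simpa [mul_smul, smul_comm (g _)] using h3.symm

/-- The adjoint of a Fourier multiplier with imaginary symbol is its negative. -/
theorem IsFourierMultiplier.inner_eq_neg {g : E → ℂ} (hg : g.HasTemperateGrowth)
    (hg' : ∀ x, conj (g x) = -g x) {u u' v v' : Lp F 2 (volume : Measure E)}
    (h : IsFourierMultiplier g u u') (h' : IsFourierMultiplier g v v') :
    ⟪u', v⟫ = -⟪u, v'⟫ := by
  rw [← Lp.inner_fourier_eq u' v, ← Lp.inner_fourier_eq u v', L2.inner_def, L2.inner_def,
    ← integral_neg]
  apply integral_congr_ae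
  filter_upwards [h.fourier_ae hg, h'.fourier_ae hg] with x h1 h2
  rw [h1, h2, inner_smul_left, inner_smul_right, hg', neg_mul]

theorem _root_.ContinuousLinearMap.toTemperedDistribution_compLpL_apply (L : F →L[ℂ] F)
    (u : Lp F 2 (volume : Measure E)) (φ : 𝓢(E, ℂ)) :
    (L.compLpL 2 volume u : 𝓢'(E, F)) φ = L ((u : 𝓢'(E, F)) φ) := by
  rw [Lp.toTemperedDistribution_apply, Lp.toTemperedDistribution_apply,
    ← L.integral_comp_comm]
  · apply integral_congr_ae
    filter_upwards [L.coeFn_compLpL (p := 2) u] with x hx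
    rw [hx, map_smul]
  · exact memLp_one_iff_integrable.mp ((Lp.memLp u).smul (φ.memLp 2 volume))

theorem IsFourierMultiplier.compLpL {g : E → ℂ} {u v : Lp F 2 (volume : Measure E)}
    (h : IsFourierMultiplier g u v) (L : F →L[ℂ] F) :
    IsFourierMultiplier g (L.compLpL 2 volume u) (L.compLpL 2 volume v) := by
  ext φ
  rw [L.toTemperedDistribution_compLpL_apply, ← h, fourierMultiplierCLM_apply_apply,
    L.toTemperedDistribution_compLpL_apply, fourierMultiplierCLM_apply_apply]

end TemperedDistribution

/-! ### The free massless operator `α·D`: symmetry and resolvent. -/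

namespace MagneticDirac

open TemperedDistribution
open scoped ComplexInnerProductSpace ComplexConjugate Matrix

noncomputable section

/-! ### The weak derivative on `[H¹]⁴` -/

theorem weakDeriv_spec (j : Fin 3) (u : sobolevH1) :
    ∂_{EuclideanSpace.single j (1 : ℝ)} ((u : SpinorL2) : 𝓢'(Space, Spinor)) =
      (weakDeriv j u : 𝓢'(Space, Spinor)) :=
  (exists_weakDeriv j u).choose_spec

theorem weakDeriv_eq_iff {j : Fin 3} {u : sobolevH1} {v : SpinorL2} :
    weakDeriv j u = v ↔ ∂_{EuclideanSpace.single j (1 : ℝ)} ((u : SpinorL2) : 𝓢'(Space, Spinor)) =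
      (v : 𝓢'(Space, Spinor)) := by
  rw [weakDeriv_spec]
  exact toTemperedDistributionCLM_injective.eq_iff.symm

/-- The symbol of `∂ⱼ`. -/
def derivSymbol (j : Fin 3) (x : Space) : ℂ :=
  (2 * Real.pi * Complex.I) * (inner ℝ x (EuclideanSpace.single j (1 : ℝ)) : ℝ)

theorem derivSymbol_hasTemperateGrowth (j : Fin 3) : (derivSymbol j).HasTemperateGrowth := by
  unfold derivSymbol
  fun_prop

theorem lineDerivOp_eq_derivSymbol (j : Fin 3) (f : 𝓢'(Space, Spinor)) :
    ∂_{EuclideanSpace.single j (1 : ℝ)} f = fourierMultiplierCLM Spinor (derivSymbol j) f := by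
  rw [lineDeriv_eq_fourierMultiplierCLM]
  have : derivSymbol j = (2 * Real.pi * Complex.I) •
      fun x : Space ↦ ((inner ℝ x (EuclideanSpace.single j (1 : ℝ)) : ℝ) : ℂ) := by
    ext x
    simp [derivSymbol]
  rw [this, fourierMultiplierCLM_smul (by fun_prop)]
  rfl

theorem weakDeriv_isFourierMultiplier (j : Fin 3) (u : sobolevH1) :
    IsFourierMultiplier (derivSymbol j) (u : SpinorL2) (weakDeriv j u) := by
  rw [IsFourierMultiplier, ← lineDerivOp_eq_derivSymbol, weakDeriv_spec]

/-- Integration by parts on `H¹`, read off from the purely imaginary symbol of `∂ⱼ`. -/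
theorem inner_weakDeriv (j : Fin 3) (u v : sobolevH1) :
    ⟪weakDeriv j u, (v : SpinorL2)⟫ = -⟪(u : SpinorL2), weakDeriv j v⟫ :=
  (weakDeriv_isFourierMultiplier j u).inner_eq_neg (derivSymbol_hasTemperateGrowth j)
    (fun x ↦ by
      simp only [derivSymbol, map_mul, Complex.conj_I, Complex.conj_ofReal, map_ofNat]
      ring) (weakDeriv_isFourierMultiplier j v)

/-! ### Constant matrices acting on spinor fields -/

theorem matrixL2_coeFn (M : Matrix (Fin 2 ⊕ Fin 2) (Fin 2 ⊕ Fin 2) ℂ) (u : SpinorL2) :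
    ∀ᵐ x, matrixL2 M u x = Matrix.toEuclideanCLM (𝕜 := ℂ) M (u x) :=
  ContinuousLinearMap.coeFn_compLpL _ u

theorem matrixL2_mul (M N : Matrix (Fin 2 ⊕ Fin 2) (Fin 2 ⊕ Fin 2) ℂ) (u : SpinorL2) :
    matrixL2 (M * N) u = matrixL2 M (matrixL2 N u) := by
  apply Lp.ext
  filter_upwards [matrixL2_coeFn (M * N) u, matrixL2_coeFn M (matrixL2 N u),
    matrixL2_coeFn N u] with x h1 h2 h3
  rw [h1, h2, h3, map_mul]
  rfl

theorem matrixL2_add (M N : Matrix (Fin 2 ⊕ Fin 2) (Fin 2 ⊕ Fin 2) ℂ) (u : SpinorL2) :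
    matrixL2 (M + N) u = matrixL2 M u + matrixL2 N u := by
  apply Lp.ext
  filter_upwards [matrixL2_coeFn (M + N) u, matrixL2_coeFn M u,
    matrixL2_coeFn N u, Lp.coeFn_add (matrixL2 M u) (matrixL2 N u)] with x h1 h2 h3 h4
  rw [h1, h4, Pi.add_apply, h2, h3, map_add]
  rfl

theorem matrixL2_smul (c : ℂ) (M : Matrix (Fin 2 ⊕ Fin 2) (Fin 2 ⊕ Fin 2) ℂ) (u : SpinorL2) :
    matrixL2 (c • M) u = c • matrixL2 M u := by
  apply Lp.ext
  filter_upwards [matrixL2_coeFn (c • M) u, matrixL2_coeFn M u,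
    Lp.coeFn_smul c (matrixL2 M u)] with x h1 h2 h4
  rw [h1, h4, Pi.smul_apply, h2, map_smul]
  rfl

theorem matrixL2_one (u : SpinorL2) : matrixL2 1 u = u := by
  apply Lp.ext
  filter_upwards [matrixL2_coeFn 1 u] with x h1
  rw [h1, map_one]
  rfl

theorem inner_toEuclideanCLM_left (M : Matrix (Fin 2 ⊕ Fin 2) (Fin 2 ⊕ Fin 2) ℂ) (x y : Spinor) :
    ⟪Matrix.toEuclideanCLM (𝕜 := ℂ) M x, y⟫ = ⟪x, Matrix.toEuclideanCLM (𝕜 := ℂ) Mᴴ y⟫ := by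
  rw [← Matrix.star_eq_conjTranspose, map_star, ContinuousLinearMap.star_eq_adjoint,
    ContinuousLinearMap.adjoint_inner_right]

theorem inner_matrixL2_left {M : Matrix (Fin 2 ⊕ Fin 2) (Fin 2 ⊕ Fin 2) ℂ} (hM : M.IsHermitian)
    (u v : SpinorL2) : ⟪matrixL2 M u, v⟫ = ⟪u, matrixL2 M v⟫ := by
  rw [L2.inner_def, L2.inner_def]
  apply integral_congr_ae
  filter_upwards [matrixL2_coeFn M u, matrixL2_coeFn M v] with x h1 h2
  rw [h1, h2, inner_toEuclideanCLM_left, hM.eq]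

theorem matrixL2_mem_sobolevH1 (M : Matrix (Fin 2 ⊕ Fin 2) (Fin 2 ⊕ Fin 2) ℂ) {u : SpinorL2}
    (hu : u ∈ sobolevH1) : matrixL2 M u ∈ sobolevH1 := by
  obtain ⟨v, hv⟩ := hu
  exact ⟨matrixL2 M v, IsFourierMultiplier.compLpL hv _⟩

/-- Pointwise application of a constant matrix, on `[H¹]⁴`. -/
def matrixH1 (M : Matrix (Fin 2 ⊕ Fin 2) (Fin 2 ⊕ Fin 2) ℂ) (u : sobolevH1) : sobolevH1 :=
  ⟨matrixL2 M u, matrixL2_mem_sobolevH1 M u.2⟩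

theorem weakDeriv_matrixH1 (j : Fin 3) (M : Matrix (Fin 2 ⊕ Fin 2) (Fin 2 ⊕ Fin 2) ℂ)
    (u : sobolevH1) : weakDeriv j (matrixH1 M u) = matrixL2 M (weakDeriv j u) := by
  rw [weakDeriv_eq_iff, lineDerivOp_eq_derivSymbol]
  exact (weakDeriv_isFourierMultiplier j u).compLpL _

/-! ### The algebra of the Dirac matrices -/

theorem pauli_isHermitian (j : Fin 3) : (pauli j).IsHermitian := by
  ext a b
  fin_cases j <;> fin_cases a <;> fin_cases b <;> simp [pauli]

theorem pauli_anticomm (j k : Fin 3) :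
    pauli j * pauli k + pauli k * pauli j = if j = k then (2 : ℂ) • 1 else 0 := by
  ext a b
  fin_cases j <;> fin_cases k <;> fin_cases a <;> fin_cases b <;>
    simp [pauli] <;> norm_num

theorem alpha_isHermitian (j : Fin 3) : (alpha j).IsHermitian := by
  rw [alpha, Matrix.IsHermitian, Matrix.fromBlocks_conjTranspose, (pauli_isHermitian j).eq]
  simp

theorem alpha_anticomm (j k : Fin 3) :
    alpha j * alpha k + alpha k * alpha j = if j = k then (2 : ℂ) • 1 else 0 := by
  have h : alpha j * alpha k + alpha k * alpha j =
      Matrix.fromBlocks (pauli j * pauli k + pauli k * pauli j) 0 0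
        (pauli j * pauli k + pauli k * pauli j) := by
    simp [alpha, Matrix.fromBlocks_multiply, Matrix.fromBlocks_add]
  rw [h, pauli_anticomm]
  split_ifs
  · rw [← Matrix.fromBlocks_one, Matrix.fromBlocks_smul, smul_zero]
  · exact Matrix.fromBlocks_zero

theorem beta_isHermitian : beta.IsHermitian := by
  rw [beta, Matrix.IsHermitian, Matrix.fromBlocks_conjTranspose]
  simp

theorem beta_mul_beta : beta * beta = 1 := by
  simp [beta, Matrix.fromBlocks_multiply]

theorem alpha_mul_beta (j : Fin 3) : alpha j * beta = (-1 : ℂ) • (beta * alpha j) := by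
  simp [alpha, beta, Matrix.fromBlocks_multiply, Matrix.fromBlocks_neg]

/-! ### The massless free Dirac operator -/

/-- The massless free Dirac operator `α · D` on `[H¹]⁴`. -/
def alphaD : sobolevH1 →ₗ[ℂ] SpinorL2 :=
  ∑ j : Fin 3, (-Complex.I) • ((matrixL2 (alpha j)).toLinearMap ∘ₗ weakDeriv j)

theorem alphaD_apply (u : sobolevH1) :
    alphaD u = ∑ j : Fin 3, (-Complex.I) • matrixL2 (alpha j) (weakDeriv j u) := by
  simp [alphaD]

theorem alphaD_symmetric (u v : sobolevH1) :
    ⟪alphaD u, (v : SpinorL2)⟫ = ⟪(u : SpinorL2), alphaD v⟫ := by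
  rw [alphaD_apply, alphaD_apply, sum_inner, inner_sum]
  refine Finset.sum_congr rfl fun j _ ↦ ?_
  have h := inner_weakDeriv j u (matrixH1 (alpha j) v)
  rw [weakDeriv_matrixH1] at h
  rw [inner_smul_left, inner_smul_right, inner_matrixL2_left (alpha_isHermitian j)]
  refine (congrArg (_ * ·) h).trans ?_
  simp

theorem alphaD_beta (u : sobolevH1) :
    alphaD (matrixH1 beta u) = -matrixL2 beta (alphaD u) := by
  rw [alphaD_apply, alphaD_apply, map_sum, ← Finset.sum_neg_distrib]
  refine Finset.sum_congr rfl fun j _ ↦ ?_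
  rw [weakDeriv_matrixH1, ← matrixL2_mul, alpha_mul_beta, matrixL2_smul, matrixL2_mul, map_smul,
    neg_one_smul, smul_neg]

/-- Here `h` is the Bessel potential of order `-2` of `f`, hence in `H²`. That regularity is
expressed by its first derivatives `h'` lying in `H¹`, so that `weakDeriv` can be applied again. -/
theorem exists_laplacian_resolvent (f : SpinorL2) : ∃ (h : sobolevH1) (h' : Fin 3 → sobolevH1),
    (∀ j, (h' j : SpinorL2) = weakDeriv j h) ∧
    (∀ j k, weakDeriv j (h' k) = weakDeriv k (h' j)) ∧
    (2 * Real.pi : ℂ) ^ 2 • (h : SpinorL2) - ∑ j, weakDeriv j (h' j) =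
      (2 * Real.pi : ℂ) ^ 2 • f := by
  set h₀ : 𝓢'(Space, Spinor) := besselPotential Space Spinor (-2) f with hh₀
  have hf : besselPotential Space Spinor 2 h₀ = f := (besselPotential_neg_apply_eq_iff 2 _ _).mp rfl
  have h2 : MemSobolev 2 2 h₀ := ⟨f, hf⟩
  obtain ⟨h, hh⟩ := memSobolev_zero_iff.mp (h2.mono (s' := 0) (by norm_num))
  have hmem : h ∈ sobolevH1 := by
    change MemSobolev 1 2 _
    rw [← hh]
    exact h2.mono (by norm_num)
  have hmem' : ∀ j, weakDeriv j ⟨h, hmem⟩ ∈ sobolevH1 := fun j ↦ by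
    change MemSobolev 1 2 _
    rw [← weakDeriv_spec]
    simp only
    rw [← hh]
    have := h2.lineDerivOp (m := (EuclideanSpace.single j (1 : ℝ) : Space))
    norm_num at this
    exact this
  have hspec : ∀ j k, ((weakDeriv j ⟨_, hmem' k⟩ : SpinorL2) : 𝓢'(Space, Spinor)) =
      ∂_{(EuclideanSpace.single j (1 : ℝ) : Space)}
        (∂_{(EuclideanSpace.single k (1 : ℝ) : Space)} h₀) := fun j k ↦ by
    rw [← weakDeriv_spec]
    simp only
    rw [← weakDeriv_spec]
    simp only
    rw [hh]
  refine ⟨⟨h, hmem⟩, fun j ↦ ⟨_, hmem' j⟩, fun j ↦ rfl, fun j k ↦ ?_, ?_⟩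
  · apply toTemperedDistributionCLM_injective
    simp only [Lp.toTemperedDistributionCLM_apply]
    rw [hspec, hspec, lineDerivOp_comm]
  · apply toTemperedDistributionCLM_injective
    simp only [map_sub, map_smul, map_sum, Lp.toTemperedDistributionCLM_apply, hspec]
    have hb := besselPotential_two_eq h₀
    rw [hf, laplacian_eq_sum (EuclideanSpace.basisFun (Fin 3) ℝ)] at hb
    simp only [EuclideanSpace.basisFun_apply] at hb
    rw [← hh]
    have hc : ((2 * Real.pi : ℂ)) ^ 2 = (((2 * Real.pi) ^ 2 : ℝ) : ℂ) := by push_cast; rfl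
    rw [hc]
    exact hb.symm

/-- Since `(α·D - is)(α·D + is) = -Δ + s²`, a preimage of `f` is `(2π)⁻²(α·D + is)h` with `((2π)² -
Δ)h = (2π)² f`. -/
theorem alphaD_sub_surjective {s : ℝ} (hs : s ^ 2 = (2 * Real.pi) ^ 2) :
    Function.Surjective (alphaD - (s * Complex.I) • sobolevH1.subtype) := by
  intro f
  obtain ⟨h, h', hh', hsymm, hf⟩ := exists_laplacian_resolvent f
  set p : sobolevH1 := ∑ k, (-Complex.I) • matrixH1 (alpha k) (h' k) with hp
  have hpval : (p : SpinorL2) = alphaD h := by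
    rw [alphaD_apply, hp]
    simp [matrixH1, hh']
  have hsq : alphaD p = -∑ j, weakDeriv j (h' j) := by
    have h1 : alphaD p =
        -∑ j, ∑ k, matrixL2 (alpha j * alpha k) (weakDeriv j (h' k)) := by
      rw [alphaD_apply, ← Finset.sum_neg_distrib]
      refine Finset.sum_congr rfl fun j _ ↦ ?_
      rw [hp, map_sum, map_sum, Finset.smul_sum, ← Finset.sum_neg_distrib]
      refine Finset.sum_congr rfl fun k _ ↦ ?_
      rw [map_smul, map_smul, weakDeriv_matrixH1, smul_smul, matrixL2_mul]
      simp
    -- Doubling the sum and swapping indices in one copy produces anticommutators `2δⱼₖ`, because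
    -- mixed derivatives commute.
    have h2 : (2 : ℂ) • ∑ j, ∑ k, matrixL2 (alpha j * alpha k) (weakDeriv j (h' k)) =
        (2 : ℂ) • ∑ j, weakDeriv j (h' j) := by
      rw [two_smul]
      nth_rw 2 [Finset.sum_comm]
      rw [← Finset.sum_add_distrib, Finset.smul_sum]
      refine Finset.sum_congr rfl fun j _ ↦ ?_
      rw [← Finset.sum_add_distrib]
      have : ∀ k, matrixL2 (alpha j * alpha k) (weakDeriv j (h' k)) +
          matrixL2 (alpha k * alpha j) (weakDeriv k (h' j)) =
          if j = k then (2 : ℂ) • weakDeriv j (h' k) else 0 := fun k ↦ by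
        rw [hsymm k j, ← matrixL2_add, alpha_anticomm]
        split_ifs
        · rw [matrixL2_smul, matrixL2_one]
        · have := matrixL2_smul 0 0 (weakDeriv j (h' k))
          simpa using this
      simp [this]
    rw [h1, smul_right_injective _ (two_ne_zero (α := ℂ)) h2]
  have hpi : (2 * Real.pi : ℂ) ^ 2 ≠ 0 := by
    have := Real.pi_ne_zero
    norm_cast
    positivity
  refine ⟨((2 * Real.pi : ℂ) ^ 2)⁻¹ • (p + (s * Complex.I) • h), ?_⟩
  rw [map_smul, inv_smul_eq_iff₀ hpi, ← hf]
  have hss : (s * Complex.I) * (s * Complex.I) = -(2 * Real.pi : ℂ) ^ 2 := by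
    have : ((s ^ 2 : ℝ) : ℂ) = (((2 * Real.pi) ^ 2 : ℝ) : ℂ) := by rw [hs]
    push_cast at this
    rw [← this]
    linear_combination (s : ℂ) ^ 2 * Complex.I_mul_I
  rw [map_add, map_smul]
  simp only [LinearMap.sub_apply, LinearMap.smul_apply, Submodule.subtype_apply, hpval, hsq]
  rw [smul_sub, smul_smul, hss, neg_smul]
  abel

end

end MagneticDirac

/-! ### The magnetic perturbation, the gap and the resolvent. -/

namespace MagneticDirac

open Submodule
open scoped ComplexInnerProductSpace ComplexConjugate Matrix Topology

noncomputable section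

/-! ### Multiplication by `α · A` -/

/-- A bound for the operator norm of the matrix `α · A(x)`. -/
def alphaDotBound (A : Space → Space) (x : Space) : ℝ :=
  ∑ j : Fin 3, ‖A x j‖ * ‖Matrix.toEuclideanCLM (𝕜 := ℂ) (alpha j)‖

theorem alphaDotMul_eq_sum (A : Space → Space) (u : Space → Spinor) (x : Space) :
    alphaDotMul A u x =
      ∑ j : Fin 3, (A x j : ℂ) • Matrix.toEuclideanCLM (𝕜 := ℂ) (alpha j) (u x) := by
  simp only [alphaDotMul, alphaDot, map_sum, map_smul, _root_.sum_apply, _root_.smul_apply]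

theorem norm_alphaDotMul_le (A : Space → Space) (u : Space → Spinor) (x : Space) :
    ‖alphaDotMul A u x‖ ≤ alphaDotBound A x * ‖u x‖ := by
  rw [alphaDotMul_eq_sum, alphaDotBound, Finset.sum_mul]
  refine norm_sum_le_of_le _ fun j _ ↦ ?_
  rw [norm_smul, mul_assoc, Complex.norm_real]
  gcongr
  exact ContinuousLinearMap.le_opNorm _ _

theorem continuous_alphaDotBound {A : Space → Space}
    (hA : ∀ j : Fin 3, Continuous fun x ↦ A x j) : Continuous (alphaDotBound A) := by
  unfold alphaDotBound
  exact continuous_finsetSum _ fun j _ ↦ (hA j).norm.mul continuous_const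

theorem tendsto_alphaDotBound {A : Space → Space}
    (hA : ∀ j : Fin 3, Tendsto (fun x ↦ A x j) (cocompact Space) (𝓝 0)) :
    Tendsto (alphaDotBound A) (cocompact Space) (𝓝 0) := by
  have h : Tendsto (alphaDotBound A) (cocompact Space)
      (𝓝 (∑ j : Fin 3, ‖(0 : ℝ)‖ * ‖Matrix.toEuclideanCLM (𝕜 := ℂ) (alpha j)‖)) :=
    tendsto_finsetSum _ fun j _ ↦ (hA j).norm.mul_const _
  simpa using h

theorem exists_alphaDotBound_le {A : Space → Space} (hA : ∀ j : Fin 3, Continuous fun x ↦ A x j)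
    (hA' : ∀ j : Fin 3, Tendsto (fun x ↦ A x j) (cocompact Space) (𝓝 0)) :
    ∃ C, ∀ x, alphaDotBound A x ≤ C := by
  have h := (tendsto_alphaDotBound hA').eventually_le_const zero_lt_one
  obtain ⟨K, hK, hKc⟩ := mem_cocompact.mp h
  obtain ⟨C, hC⟩ := (hK.image (continuous_alphaDotBound hA)).bddAbove
  refine ⟨max C 1, fun x ↦ ?_⟩
  by_cases hx : x ∈ K
  · exact le_max_of_le_left (hC ⟨x, hx, rfl⟩)
  · exact le_max_of_le_right (hKc hx)

theorem memLp_alphaDotMul {A : Space → Space} (hA : ∀ j : Fin 3, Continuous fun x ↦ A x j) {C : ℝ}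
    (hC : ∀ x, alphaDotBound A x ≤ C) (u : SpinorL2) : MemLp (alphaDotMul A u) 2 volume := by
  refine (Lp.memLp u).of_le_mul (c := C) ?_ (ae_of_all _ fun x ↦ ?_)
  · have hu := (Lp.memLp u).1
    have : alphaDotMul A u = fun x ↦
        ∑ j : Fin 3, (A x j : ℂ) • Matrix.toEuclideanCLM (𝕜 := ℂ) (alpha j) (u x) :=
      funext (alphaDotMul_eq_sum A u)
    rw [this]
    refine Finset.aestronglyMeasurable_fun_sum _ fun j _ ↦ ?_
    have h1 : AEStronglyMeasurable (fun x ↦ (A x j : ℂ)) volume :=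
      (Complex.continuous_ofReal.comp (hA j)).aestronglyMeasurable
    have h2 : AEStronglyMeasurable (fun x ↦ Matrix.toEuclideanCLM (𝕜 := ℂ) (alpha j) (u x))
      volume := (ContinuousLinearMap.continuous _).comp_aestronglyMeasurable hu
    exact h1.smul h2
  · exact (norm_alphaDotMul_le A u x).trans (by gcongr; exact hC x)

/-- The everywhere defined `B` replaces the partial map `magneticTerm` below; only its a.e. formula
is used. -/
theorem exists_bounded_alphaDotMul {A : Space → Space}
    (hA : ∀ j : Fin 3, Continuous fun x ↦ A x j) {C : ℝ} (hC : ∀ x, alphaDotBound A x ≤ C) :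
    ∃ B : SpinorL2 →L[ℂ] SpinorL2, ∀ u, B u =ᵐ[volume] alphaDotMul A u := by
  have hmem := memLp_alphaDotMul hA hC
  let L : SpinorL2 →ₗ[ℂ] SpinorL2 :=
    { toFun := fun u ↦ magneticTerm A ⟨u, hmem u⟩
      map_add' := fun u v ↦ (magneticTerm A).map_add ⟨u, hmem u⟩ ⟨v, hmem v⟩
      map_smul' := fun c u ↦ (magneticTerm A).map_smul c ⟨u, hmem u⟩ }
  have hL : ∀ u, L u =ᵐ[volume] alphaDotMul A u := fun u ↦ MemLp.coeFn_toLp (hmem u)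
  refine ⟨L.mkContinuous C fun u ↦ ?_, hL⟩
  apply Lp.norm_le_mul_norm_of_ae_le_mul
  filter_upwards [hL u] with x hx
  rw [hx]
  exact (norm_alphaDotMul_le A u x).trans (by gcongr; exact hC x)

theorem alphaDot_isHermitian (A : Space → Space) (x : Space) : (alphaDot A x).IsHermitian := by
  simp only [alphaDot, Matrix.IsHermitian, Matrix.conjTranspose_sum, Matrix.conjTranspose_smul,
    (alpha_isHermitian _).eq]
  simp

theorem alphaDot_mul_beta (A : Space → Space) (x : Space) :
    alphaDot A x * beta = -(beta * alphaDot A x) := by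
  simp only [alphaDot, Finset.sum_mul, Finset.mul_sum, ← Finset.sum_neg_distrib]
  refine Finset.sum_congr rfl fun j _ ↦ ?_
  rw [smul_mul_assoc, alpha_mul_beta, mul_smul_comm, neg_one_smul, smul_neg]

section MagneticOperator

variable {A : Space → Space} {B : SpinorL2 →L[ℂ] SpinorL2}

theorem inner_alphaDotMul_left (hB : ∀ u, B u =ᵐ[volume] alphaDotMul A u) (u v : SpinorL2) :
    ⟪B u, v⟫ = ⟪u, B v⟫ := by
  rw [L2.inner_def, L2.inner_def]
  apply integral_congr_ae
  filter_upwards [hB u, hB v] with x h1 h2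
  rw [h1, h2, alphaDotMul, alphaDotMul, inner_toEuclideanCLM_left, (alphaDot_isHermitian A x).eq]

theorem alphaDotMul_matrixL2_beta (hB : ∀ u, B u =ᵐ[volume] alphaDotMul A u) (u : SpinorL2) :
    B (matrixL2 beta u) = -matrixL2 beta (B u) := by
  apply Lp.ext
  filter_upwards [hB u, hB (matrixL2 beta u), matrixL2_coeFn beta u, matrixL2_coeFn beta (B u),
    Lp.coeFn_neg (matrixL2 beta (B u))] with x h1 h2 h3 h4 h5
  rw [h5, Pi.neg_apply, h2, h4, h1, alphaDotMul, alphaDotMul, h3, ← mul_apply_eq_comp,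
    ← mul_apply_eq_comp, ← map_mul, ← map_mul, alphaDot_mul_beta, map_neg]
  rfl

/-- The massless magnetic Dirac operator `α · D - B` on `[H¹]⁴`, for a bounded operator `B`. -/
def masslessDirac (B : SpinorL2 →L[ℂ] SpinorL2) : sobolevH1 →ₗ[ℂ] SpinorL2 :=
  alphaD - B.toLinearMap ∘ₗ sobolevH1.subtype

/-- The Dirac operator `α · D - B + m β` on `[H¹]⁴`, for a bounded operator `B`. -/
def massiveDirac (m : ℝ) (B : SpinorL2 →L[ℂ] SpinorL2) : sobolevH1 →ₗ[ℂ] SpinorL2 :=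
  masslessDirac B + ((m : ℂ) • matrixL2 beta).toLinearMap ∘ₗ sobolevH1.subtype

theorem masslessDirac_apply (u : sobolevH1) : masslessDirac B u = alphaD u - B u := rfl

theorem massiveDirac_apply (m : ℝ) (u : sobolevH1) :
    massiveDirac m B u = masslessDirac B u + (m : ℂ) • matrixL2 beta u := rfl

theorem masslessDirac_symmetric (hB : ∀ u, B u =ᵐ[volume] alphaDotMul A u) (u v : sobolevH1) :
    ⟪masslessDirac B u, (v : SpinorL2)⟫ = ⟪(u : SpinorL2), masslessDirac B v⟫ := by
  rw [masslessDirac_apply, masslessDirac_apply, inner_sub_left, inner_sub_right, alphaD_symmetric,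
    inner_alphaDotMul_left hB]

theorem massiveDirac_symmetric (m : ℝ) (hB : ∀ u, B u =ᵐ[volume] alphaDotMul A u)
    (u v : sobolevH1) :
    ⟪massiveDirac m B u, (v : SpinorL2)⟫ = ⟪(u : SpinorL2), massiveDirac m B v⟫ := by
  rw [massiveDirac_apply, massiveDirac_apply, inner_add_left, inner_add_right,
    masslessDirac_symmetric hB, inner_smul_left, inner_smul_right,
    inner_matrixL2_left beta_isHermitian, Complex.conj_ofReal]

theorem norm_matrixL2_beta (u : SpinorL2) : ‖matrixL2 beta u‖ = ‖u‖ := by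
  have h : ⟪matrixL2 beta u, matrixL2 beta u⟫ = ⟪u, u⟫ := by
    rw [inner_matrixL2_left beta_isHermitian, ← matrixL2_mul, beta_mul_beta, matrixL2_one]
  rw [inner_self_eq_norm_sq_to_K, inner_self_eq_norm_sq_to_K] at h
  exact (sq_eq_sq₀ (norm_nonneg _) (norm_nonneg _)).mp (by exact_mod_cast h)

/-- The operator `α · (D - A)` anticommutes with `β`, so `β` opens a gap around `0`. -/
theorem sq_le_norm_massiveDirac_sq (m : ℝ) (hB : ∀ u, B u =ᵐ[volume] alphaDotMul A u)
    (u : sobolevH1) : m ^ 2 * ‖(u : SpinorL2)‖ ^ 2 ≤ ‖massiveDirac m B u‖ ^ 2 := by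
  have hanti : masslessDirac B (matrixH1 beta u) = -matrixL2 beta (masslessDirac B u) := by
    rw [masslessDirac_apply, masslessDirac_apply, alphaD_beta, map_sub]
    have := alphaDotMul_matrixL2_beta hB u
    rw [show ((matrixH1 beta u : sobolevH1) : SpinorL2) = matrixL2 beta u from rfl, this]
    abel
  -- Symmetry and anticommutation show that this inner product is minus its own conjugate.
  have hre : (⟪masslessDirac B u, matrixL2 beta u⟫).re = 0 := by
    have h1 : ⟪masslessDirac B u, matrixL2 beta u⟫ = -⟪matrixL2 beta u, masslessDirac B u⟫ := by
      refine (masslessDirac_symmetric hB u (matrixH1 beta u)).trans ?_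
      rw [hanti, inner_neg_right, inner_matrixL2_left beta_isHermitian]
    rw [← inner_conj_symm (matrixL2 beta (u : SpinorL2))] at h1
    have := congrArg Complex.re h1
    simp only [Complex.neg_re, Complex.conj_re] at this
    linarith
  rw [massiveDirac_apply, norm_add_sq (𝕜 := ℂ), inner_smul_right, norm_smul, norm_matrixL2_beta]
  simp [hre, mul_pow]

/-- The perturbation `V = mβ - B` is bounded but need not be small. It is absorbed at `iη` with `|η|
> ‖V‖`, where `α·D - iη` is bounded below by `|η|`; the gap estimate then carries invertibility to
`z`. -/
theorem massiveDirac_hasBoundedInverse (m : ℝ) (hB : ∀ u, B u =ᵐ[volume] alphaDotMul A u)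
    {z : ℂ} (hz : z.im = 0 → |z.re| < m) :
    HasBoundedInverse (massiveDirac m B - z • sobolevH1.subtype) := by
  set V : SpinorL2 →L[ℂ] SpinorL2 := (m : ℂ) • matrixL2 beta - B with hV
  have key : ∀ s : ℝ, s ^ 2 = (2 * Real.pi) ^ 2 → ∀ n : ℕ, ‖V‖ < |s * (3 / 2) ^ n| →
      HasBoundedInverse
        (massiveDirac m B - ((s * (3 / 2) ^ n : ℝ) * Complex.I) • sobolevH1.subtype) := by
    intro s hs n hn
    have hs0 : s ≠ 0 := by
      rintro rfl
      have := Real.pi_pos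
      nlinarith
    have h1 := hasBoundedInverse_sub_I_smul_pow alphaD_symmetric hs0 (alphaD_sub_surjective hs) n
    have h2 := h1.add_bounded (c := |s * (3 / 2) ^ n|) (fun x ↦ by
      have := le_norm_sub_I_smul alphaD_symmetric (m := 0) (fun x ↦ by simp) (s * (3 / 2) ^ n) x
      simpa [Real.sqrt_sq_eq_abs] using this) hn
    refine (congrArg HasBoundedInverse (LinearMap.ext fun u ↦ ?_)).mpr h2
    simp only [LinearMap.sub_apply, LinearMap.smul_apply, LinearMap.add_apply,
      LinearMap.comp_apply, Submodule.subtype_apply, massiveDirac_apply, masslessDirac_apply,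
      ContinuousLinearMap.coe_coe, hV, _root_.sub_apply, _root_.smul_apply]
    abel
  have hlarge : ∀ C : ℝ, ∃ n : ℕ,
      C < 2 * Real.pi * (3 / 2) ^ n ∧ ‖V‖ < 2 * Real.pi * (3 / 2) ^ n := by
    intro C
    obtain ⟨n, hn⟩ := pow_unbounded_of_one_lt (max C ‖V‖) (by norm_num : (1 : ℝ) < 3 / 2)
    have hpi : 1 ≤ 2 * Real.pi := by linarith [Real.pi_gt_three]
    have hle : (3 / 2 : ℝ) ^ n ≤ 2 * Real.pi * (3 / 2) ^ n :=
      le_mul_of_one_le_left (by positivity) hpi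
    exact ⟨n, ((le_max_left _ _).trans_lt hn).trans_le hle,
      ((le_max_right _ _).trans_lt hn).trans_le hle⟩
  refine hasBoundedInverse_of_gap (massiveDirac_symmetric m hB) (sq_le_norm_massiveDirac_sq m hB)
    (fun C ↦ ?_) (fun C ↦ ?_) hz
  · obtain ⟨n, h1, h2⟩ := hlarge C
    exact ⟨_, h1.le, key _ rfl n (h2.trans_le (le_abs_self _))⟩
  · obtain ⟨n, h1, h2⟩ := hlarge (-C)
    refine ⟨-(2 * Real.pi) * (3 / 2) ^ n, by linarith, key _ (neg_sq _) n ?_⟩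
    rw [neg_mul, abs_neg]
    exact h2.trans_le (le_abs_self _)

theorem diracOperator_eq (m : ℝ) (hB : ∀ u, B u =ᵐ[volume] alphaDotMul A u) :
    diracOperator m A = ⟨sobolevH1, massiveDirac m B⟩ := by
  have hmem : ∀ u : SpinorL2, u ∈ magneticDomain A := fun u ↦
    (memLp_congr_ae (hB u)).mp (Lp.memLp (B u))
  have hdom : (diracOperator m A).domain = sobolevH1 :=
    inf_eq_left.mpr fun u _ ↦ hmem u
  refine LinearPMap.ext hdom fun u hu hu' ↦ ?_
  have hmag : magneticTerm A ⟨u, hmem u⟩ = B u :=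
    Lp.ext ((MemLp.coeFn_toLp (hmem u)).trans (hB u).symm)
  have h1 : diracOperator m A ⟨u, hu⟩ = freeDirac m ⟨u, hu'⟩ - magneticTerm A ⟨u, hmem u⟩ := rfl
  have h2 : freeDirac m ⟨u, hu'⟩ = alphaD ⟨u, hu'⟩ + (m : ℂ) • matrixL2 beta u := rfl
  have h3 : (⟨sobolevH1, massiveDirac m B⟩ : SpinorL2 →ₗ.[ℂ] SpinorL2) ⟨u, hu'⟩ =
    alphaD ⟨u, hu'⟩ - B u + (m : ℂ) • matrixL2 beta u := rfl
  rw [h1, h2, h3, hmag]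
  abel

end MagneticOperator

end

end MagneticDirac

/-! ### Wave packets and the computation of the spectrum. -/

namespace MagneticDirac

open Submodule
open scoped ComplexInnerProductSpace ComplexConjugate Matrix Topology ContDiff

noncomputable section

/-! ### Wave packets -/

/-- A smooth bump function equal to `1` on the unit ball and supported in the ball of
radius `2`. -/
def cutoff : ContDiffBump (0 : Space) := ⟨1, 2, one_pos, one_lt_two⟩

/-- The cut-off function rescaled to the ball with center `x₀` and radius `2 R`. -/
def scaledCutoff (x₀ : Space) (R : ℝ) (x : Space) : ℝ := cutoff (R⁻¹ • (x - x₀))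

theorem contDiff_scaledCutoff (x₀ : Space) (R : ℝ) : ContDiff ℝ ∞ (scaledCutoff x₀ R) :=
  cutoff.contDiff.comp (by fun_prop : ContDiff ℝ ∞ fun x : Space ↦ R⁻¹ • (x - x₀))

theorem scaledCutoff_eq_one {x₀ : Space} {R : ℝ} (hR : 0 < R) {x : Space}
    (hx : x ∈ Metric.closedBall x₀ R) : scaledCutoff x₀ R x = 1 := by
  apply cutoff.one_of_mem_closedBall
  rw [mem_closedBall_iff_norm] at hx ⊢
  rw [sub_zero, norm_smul, norm_inv, Real.norm_of_nonneg hR.le, inv_mul_le_iff₀ hR]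
  simpa [cutoff] using hx

theorem tsupport_scaledCutoff_subset (x₀ : Space) {R : ℝ} (hR : 0 < R) :
    tsupport (scaledCutoff x₀ R) ⊆ Metric.closedBall x₀ (2 * R) := by
  refine closure_minimal (fun x hx ↦ ?_) Metric.isClosed_closedBall
  have h : R⁻¹ • (x - x₀) ∈ Function.support cutoff := hx
  rw [cutoff.support_eq, mem_ball_iff_norm, sub_zero, norm_smul, norm_inv,
    Real.norm_of_nonneg hR.le, inv_mul_lt_iff₀ hR] at h
  rw [mem_closedBall_iff_norm]
  simpa [cutoff, mul_comm] using h.le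

theorem exists_norm_fderiv_scaledCutoff_le : ∃ C : ℝ, ∀ (x₀ : Space) (R : ℝ), 0 < R →
    ∀ x, ‖fderiv ℝ (scaledCutoff x₀ R) x‖ ≤ C / R := by
  have hsmooth : ContDiff ℝ ∞ cutoff := cutoff.contDiff
  obtain ⟨C, hC⟩ := (hsmooth.continuous_fderiv (by simp)).bounded_above_of_compact_support
    (cutoff.hasCompactSupport.fderiv (𝕜 := ℝ))
  refine ⟨C, fun x₀ R hR x ↦ ?_⟩
  have h1 : HasFDerivAt (fun x : Space ↦ R⁻¹ • (x - x₀))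
      (R⁻¹ • ContinuousLinearMap.id ℝ Space) x :=
    ((hasFDerivAt_id x).sub_const x₀).const_smul R⁻¹
  have h2 := (hsmooth.differentiable (by simp) (R⁻¹ • (x - x₀))).hasFDerivAt.comp x h1
  have h3 : fderiv ℝ (scaledCutoff x₀ R) x = _ := h2.fderiv
  rw [h3]
  calc _ ≤ C * ‖R⁻¹ • ContinuousLinearMap.id ℝ Space‖ :=
        (ContinuousLinearMap.opNorm_comp_le _ _).trans (by gcongr; exact hC _)
    _ ≤ C * (R⁻¹ * 1) := by
        have := (norm_nonneg _).trans (hC 0)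
        rw [norm_smul, norm_inv, Real.norm_of_nonneg hR.le]
        gcongr
        exact ContinuousLinearMap.norm_id_le
    _ = C / R := by rw [mul_one, div_eq_mul_inv]

/-- The plane wave with wave vector `(0, 0, κ)`. -/
def planeWave (κ : ℝ) (x : Space) : ℂ := Complex.exp ((κ * x 2 : ℝ) * Complex.I)

theorem norm_planeWave (κ : ℝ) (x : Space) : ‖planeWave κ x‖ = 1 :=
  Complex.norm_exp_ofReal_mul_I _

theorem contDiff_planeWave (κ : ℝ) : ContDiff ℝ ∞ (planeWave κ) := by
  unfold planeWave
  refine Complex.contDiff_exp.comp (ContDiff.mul ?_ contDiff_const)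
  refine Complex.ofRealCLM.contDiff.comp (contDiff_const.mul ?_)
  exact (EuclideanSpace.proj (𝕜 := ℝ) (2 : Fin 3)).contDiff

/-- The wave packet `x ↦ χ((x - x₀) / R) exp(i κ x₃) w`. -/
def wavePacketFun (κ : ℝ) (w : Spinor) (x₀ : Space) (R : ℝ) (x : Space) : Spinor :=
  ((scaledCutoff x₀ R x : ℂ) * planeWave κ x) • w

theorem contDiff_wavePacketFun (κ : ℝ) (w : Spinor) (x₀ : Space) (R : ℝ) :
    ContDiff ℝ ∞ (wavePacketFun κ w x₀ R) :=
  ((Complex.ofRealCLM.contDiff.comp (contDiff_scaledCutoff x₀ R)).mul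
    (contDiff_planeWave κ)).smul contDiff_const

theorem wavePacketFun_eq_zero (κ : ℝ) (w : Spinor) {x₀ : Space} {R : ℝ} (hR : 0 < R) {x : Space}
    (hx : x ∉ Metric.closedBall x₀ (2 * R)) : wavePacketFun κ w x₀ R x = 0 := by
  have : scaledCutoff x₀ R x = 0 :=
    image_eq_zero_of_notMem_tsupport fun h ↦ hx (tsupport_scaledCutoff_subset x₀ hR h)
  simp [wavePacketFun, this]

theorem hasCompactSupport_wavePacketFun (κ : ℝ) (w : Spinor) (x₀ : Space) {R : ℝ} (hR : 0 < R) :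
    HasCompactSupport (wavePacketFun κ w x₀ R) :=
  HasCompactSupport.intro (isCompact_closedBall x₀ (2 * R)) fun _ hx ↦
    wavePacketFun_eq_zero κ w hR hx

theorem lineDeriv_wavePacketFun (κ : ℝ) (w : Spinor) (x₀ : Space) (R : ℝ) (j : Fin 3) (x : Space) :
    lineDeriv ℝ (wavePacketFun κ w x₀ R) x (EuclideanSpace.single j 1) =
      (if j = 2 then κ * Complex.I else 0) • wavePacketFun κ w x₀ R x +
      ((fderiv ℝ (scaledCutoff x₀ R) x (EuclideanSpace.single j 1) : ℂ) * planeWave κ x) • w := by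
  set e : Space := EuclideanSpace.single j 1 with he
  have hχ : HasDerivAt (fun t : ℝ ↦ (scaledCutoff x₀ R (x + t • e) : ℂ))
      (fderiv ℝ (scaledCutoff x₀ R) x e : ℂ) 0 := by
    have h := ((contDiff_scaledCutoff x₀ R).differentiable (by simp) x).hasFDerivAt.hasLineDerivAt e
    exact HasDerivAt.ofReal_comp h
  have hp : HasDerivAt (fun t : ℝ ↦ planeWave κ (x + t • e))
      (planeWave κ x * (if j = 2 then κ * Complex.I else 0)) 0 := by
    have h1 : HasDerivAt (fun t : ℝ ↦ ((κ * (x + t • e) 2 : ℝ) : ℂ) * Complex.I)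
        (if j = 2 then κ * Complex.I else 0) 0 := by
      have h2 : HasDerivAt (fun t : ℝ ↦ κ * (x + t • e) 2) (κ * e 2) 0 := by
        have h3 : HasDerivAt (fun t : ℝ ↦ x 2 + t * e 2) (e 2) 0 := by
          simpa using ((hasDerivAt_id (0 : ℝ)).mul_const (e 2)).const_add (x 2)
        simpa using h3.const_mul κ
      refine (h2.ofReal_comp.mul_const Complex.I).congr_deriv ?_
      rw [he]
      fin_cases j <;> simp
    have := h1.cexp
    simpa [planeWave] using this
  have h := (hχ.mul hp).smul_const w
  have h' : HasLineDerivAt ℝ (wavePacketFun κ w x₀ R) _ x e := h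
  rw [h'.lineDeriv]
  simp only [zero_smul, add_zero, wavePacketFun]
  rw [smul_smul, ← add_smul]
  congr 1
  ring

/-- The wave packet as a Schwartz function. -/
def wavePacket (κ : ℝ) (w : Spinor) (x₀ : Space) {R : ℝ} (hR : 0 < R) : 𝓢(Space, Spinor) :=
  (hasCompactSupport_wavePacketFun κ w x₀ hR).toSchwartzMap (contDiff_wavePacketFun κ w x₀ R)

theorem schwartz_toLp_mem_sobolevH1 (f : 𝓢(Space, Spinor)) :
    (f.toLp 2 volume : SpinorL2) ∈ sobolevH1 := by
  change TemperedDistribution.MemSobolev 1 2 _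
  rw [Lp.toTemperedDistribution_toLp_eq]
  exact f.memSobolev

theorem weakDeriv_schwartz (f : 𝓢(Space, Spinor)) (j : Fin 3) :
    weakDeriv j ⟨f.toLp 2 volume, schwartz_toLp_mem_sobolevH1 f⟩ =
      (∂_{(EuclideanSpace.single j (1 : ℝ) : Space)} f).toLp 2 volume := by
  rw [weakDeriv_eq_iff, Lp.toTemperedDistribution_toLp_eq, Lp.toTemperedDistribution_toLp_eq,
    TemperedDistribution.lineDerivOp_toTemperedDistributionCLM_eq]

/-- A multiple of the indicator function of a closed ball, in `L²`. -/
def ballIndicator (x₀ : Space) (r c : ℝ) : Lp ℝ 2 (volume : Measure Space) :=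
  indicatorConstLp 2 (measurableSet_closedBall (x := x₀) (ε := r)) measure_closedBall_lt_top.ne c

theorem ballIndicator_coeFn (x₀ : Space) (r c : ℝ) :
    ballIndicator x₀ r c =ᵐ[volume] (Metric.closedBall x₀ r).indicator fun _ ↦ c :=
  indicatorConstLp_coeFn

theorem norm_ballIndicator (x₀ : Space) (r c : ℝ) :
    ‖ballIndicator x₀ r c‖ = ‖c‖ * √(volume.real (Metric.closedBall x₀ r)) := by
  rw [ballIndicator, norm_indicatorConstLp two_ne_zero ENNReal.ofNat_ne_top, Real.sqrt_eq_rpow]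
  norm_num

theorem volume_closedBall_two_mul (x₀ : Space) {R : ℝ} (hR : 0 < R) :
    volume.real (Metric.closedBall x₀ (2 * R)) = 8 * volume.real (Metric.closedBall x₀ R) := by
  rw [measureReal_def, measureReal_def, Measure.addHaar_closedBall _ _ (by positivity),
    Measure.addHaar_closedBall _ _ hR.le, ENNReal.toReal_mul, ENNReal.toReal_mul,
    ENNReal.toReal_ofReal (by positivity), ENNReal.toReal_ofReal (by positivity),
    finrank_euclideanSpace_fin]
  ring

theorem volume_closedBall_pos (x₀ : Space) {R : ℝ} (hR : 0 < R) :
    0 < volume.real (Metric.closedBall x₀ R) :=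
  ENNReal.toReal_pos (Metric.measure_closedBall_pos volume x₀ hR).ne'
    measure_closedBall_lt_top.ne

theorem le_norm_wavePacket (κ : ℝ) (w : Spinor) (x₀ : Space) {R : ℝ} (hR : 0 < R) :
    ‖w‖ * √(volume.real (Metric.closedBall x₀ R)) ≤ ‖(wavePacket κ w x₀ hR).toLp 2 volume‖ := by
  have h : ‖ballIndicator x₀ R ‖w‖‖ ≤ ‖(wavePacket κ w x₀ hR).toLp 2 volume‖ := by
    apply Lp.norm_le_norm_of_ae_le
    filter_upwards [(wavePacket κ w x₀ hR).coeFn_toLp 2, ballIndicator_coeFn x₀ R ‖w‖]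
      with x h1 h2
    rw [h1, h2]
    by_cases hx : x ∈ Metric.closedBall x₀ R
    · change _ ≤ ‖wavePacketFun κ w x₀ R x‖
      rw [Set.indicator_of_mem hx, wavePacketFun, scaledCutoff_eq_one hR hx, norm_smul]
      simp [norm_planeWave]
    · rw [Set.indicator_of_notMem hx, norm_zero]
      positivity
  rwa [norm_ballIndicator, norm_norm] at h

theorem norm_lineDeriv_wavePacketFun_sub_le (κ : ℝ) (w : Spinor) (x₀ : Space) {R : ℝ} (hR : 0 < R)
    {C : ℝ} (hC : ∀ x, ‖fderiv ℝ (scaledCutoff x₀ R) x‖ ≤ C) (j : Fin 3) (x : Space) :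
    ‖lineDeriv ℝ (wavePacketFun κ w x₀ R) x (EuclideanSpace.single j 1) -
      (if j = 2 then κ * Complex.I else 0) • wavePacketFun κ w x₀ R x‖ ≤
    ‖(Metric.closedBall x₀ (2 * R)).indicator (fun _ ↦ C * ‖w‖) x‖ := by
  have hC0 : 0 ≤ C := (norm_nonneg _).trans (hC 0)
  rw [lineDeriv_wavePacketFun, add_sub_cancel_left, norm_smul, norm_mul, norm_planeWave, mul_one,
    Complex.norm_real]
  by_cases hx : x ∈ Metric.closedBall x₀ (2 * R)
  · rw [Set.indicator_of_mem hx, Real.norm_of_nonneg (by positivity : 0 ≤ C * ‖w‖)]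
    gcongr
    refine (ContinuousLinearMap.le_opNorm _ _).trans ?_
    rw [PiLp.norm_single, norm_one, mul_one]
    exact hC x
  · have : fderiv ℝ (scaledCutoff x₀ R) x = 0 :=
      image_eq_zero_of_notMem_tsupport fun h ↦
        hx (tsupport_scaledCutoff_subset x₀ hR (tsupport_fderiv_subset ℝ h))
    rw [Set.indicator_of_notMem hx, this]
    simp

/-- The error is at most `C‖w‖` and lives on the ball of radius `2R`, whose volume is `8` times that
of the ball where the packet has modulus `‖w‖`; hence `√8`. -/
theorem norm_weakDeriv_wavePacket_sub_le (κ : ℝ) (w : Spinor) (x₀ : Space) {R : ℝ} (hR : 0 < R)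
    {C : ℝ} (hC : ∀ x, ‖fderiv ℝ (scaledCutoff x₀ R) x‖ ≤ C) (j : Fin 3) :
    ‖weakDeriv j ⟨(wavePacket κ w x₀ hR).toLp 2 volume, schwartz_toLp_mem_sobolevH1 _⟩ -
      (if j = 2 then κ * Complex.I else 0) • (wavePacket κ w x₀ hR).toLp 2 volume‖ ≤
    C * √8 * ‖(wavePacket κ w x₀ hR).toLp 2 volume‖ := by
  have hC0 : 0 ≤ C := (norm_nonneg _).trans (hC 0)
  rw [weakDeriv_schwartz]
  set f := wavePacket κ w x₀ hR with hf
  set c : ℂ := if j = 2 then κ * Complex.I else 0 with hc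
  have h : ‖(∂_{(EuclideanSpace.single j (1 : ℝ) : Space)} f).toLp 2 volume -
      c • f.toLp 2 volume‖ ≤ ‖ballIndicator x₀ (2 * R) (C * ‖w‖)‖ := by
    apply Lp.norm_le_norm_of_ae_le
    filter_upwards [f.coeFn_toLp 2, ballIndicator_coeFn x₀ (2 * R) (C * ‖w‖),
      (∂_{(EuclideanSpace.single j (1 : ℝ) : Space)} f).coeFn_toLp 2,
      Lp.coeFn_sub ((∂_{(EuclideanSpace.single j (1 : ℝ) : Space)} f).toLp 2 volume)
        (c • f.toLp 2 volume),
      Lp.coeFn_smul c (f.toLp 2 volume)] with x h1 h2 h3 h4 h5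
    rw [h4, h2, Pi.sub_apply, h3, h5, Pi.smul_apply, h1, SchwartzMap.lineDerivOp_apply]
    exact norm_lineDeriv_wavePacketFun_sub_le κ w x₀ hR hC j x
  refine h.trans ?_
  rw [norm_ballIndicator, volume_closedBall_two_mul x₀ hR, Real.sqrt_mul (by norm_num),
    Real.norm_of_nonneg (by positivity)]
  calc _ = C * √8 * (‖w‖ * √(volume.real (Metric.closedBall x₀ R))) := by ring
    _ ≤ _ := by
      gcongr
      exact le_norm_wavePacket κ w x₀ hR

/-- Uniformity of `C` in `x₀` and `R` lets `R` be fixed before the packet is moved to infinity. -/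
theorem exists_wavePacket : ∃ C : ℝ, ∀ (κ : ℝ) (w : Spinor), w ≠ 0 → ∀ (x₀ : Space) (R : ℝ),
    0 < R → ∃ u : sobolevH1, (u : SpinorL2) ≠ 0 ∧
      (∀ j, ‖weakDeriv j u - (if j = 2 then κ * Complex.I else 0) • (u : SpinorL2)‖ ≤
        C / R * ‖(u : SpinorL2)‖) ∧
      ∀ᵐ x, (∃ c : ℂ, (u : SpinorL2) x = c • w) ∧
        (x ∉ Metric.closedBall x₀ (2 * R) → (u : SpinorL2) x = 0) := by
  obtain ⟨C, hC⟩ := exists_norm_fderiv_scaledCutoff_le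
  refine ⟨C * √8, fun κ w hw x₀ R hR ↦
    ⟨⟨(wavePacket κ w x₀ hR).toLp 2 volume, schwartz_toLp_mem_sobolevH1 _⟩, ?_, fun j ↦ ?_, ?_⟩⟩
  · rw [← norm_pos_iff]
    exact lt_of_lt_of_le (mul_pos (norm_pos_iff.mpr hw)
      (Real.sqrt_pos.mpr (volume_closedBall_pos x₀ hR))) (le_norm_wavePacket κ w x₀ hR)
  · refine (norm_weakDeriv_wavePacket_sub_le κ w x₀ hR (hC x₀ R hR) j).trans_eq ?_
    rw [div_mul_eq_mul_div]
  · filter_upwards [(wavePacket κ w x₀ hR).coeFn_toLp 2] with x h1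
    exact ⟨⟨_, h1⟩, fun hx ↦ h1.trans (wavePacketFun_eq_zero κ w hR hx)⟩

/-! ### The spectrum -/

theorem exists_planeWave_spinor {m l : ℝ} (hm : m ≠ 0) (hl : m ^ 2 ≤ l ^ 2) : ∃ (κ : ℝ) (w : Spinor), w ≠ 0 ∧
    Matrix.toEuclideanCLM (𝕜 := ℂ) ((κ : ℂ) • alpha 2 + (m : ℂ) • beta) w = (l : ℂ) • w := by
  set κ := √(l ^ 2 - m ^ 2) with hκ
  have hκ2 : κ ^ 2 = l ^ 2 - m ^ 2 := Real.sq_sqrt (by linarith)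
  have hκ2' : (κ : ℂ) ^ 2 = l ^ 2 - m ^ 2 := by exact_mod_cast hκ2
  -- As `σ₃` fixes the first basis vector of `ℂ²`, the matrix acts on the first components of the
  -- two blocks as `!![m, κ; κ, -m]`.
  have key : ∀ a b : ℂ, κ * b + m * a = l * a → κ * a - m * b = l * b →
      Matrix.toEuclideanCLM (𝕜 := ℂ) ((κ : ℂ) • alpha 2 + (m : ℂ) • beta)
        (WithLp.toLp 2 (Sum.elim ![a, 0] ![b, 0])) =
      (l : ℂ) • (WithLp.toLp 2 (Sum.elim ![a, 0] ![b, 0]) : Spinor) := by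
    intro a b h1 h2
    rw [Matrix.toEuclideanCLM_toLp]
    ext i
    rcases i with i | i <;> fin_cases i <;>
      simp [Matrix.mulVec, dotProduct, alpha, beta, pauli, Fin.sum_univ_two, Matrix.one_apply]
    · linear_combination h1
    · linear_combination h2
  -- The eigenvectors `(l + m, κ)` and `(κ, l - m)` can vanish only at `l = -m` and `l = m`
  -- respectively, so neither serves every `l`.
  by_cases h : l = m
  · refine ⟨κ, _, ?_, key (l + m) κ ?_ ?_⟩
    · intro h0
      have h1 : (l + m : ℂ) = 0 := congrArg (fun v : Spinor ↦ v (Sum.inl 0)) h0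
      rw [h, ← two_mul] at h1
      simp [hm] at h1
    · linear_combination hκ2'
    · ring
  · refine ⟨κ, _, ?_, key κ (l - m) ?_ ?_⟩
    · intro h0
      have h1 : (l - m : ℂ) = 0 := congrArg (fun v : Spinor ↦ v (Sum.inr 0)) h0
      exact h (by exact_mod_cast sub_eq_zero.mp h1)
    · ring
    · linear_combination hκ2'

theorem matrixL2_eq_zero {M : Matrix (Fin 2 ⊕ Fin 2) (Fin 2 ⊕ Fin 2) ℂ} {w : Spinor}
    (hM : Matrix.toEuclideanCLM (𝕜 := ℂ) M w = 0) {u : SpinorL2}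
    (hu : ∀ᵐ x, ∃ c : ℂ, u x = c • w) : matrixL2 M u = 0 := by
  apply Lp.ext
  filter_upwards [matrixL2_coeFn M u, hu, Lp.coeFn_zero Spinor 2 (volume : Measure Space)]
    with x h1 ⟨c, h2⟩ h3
  rw [h1, h2, h3, map_smul, hM, smul_zero, Pi.zero_apply]

/-- `κα₃ + mβ - l` kills `u` pointwise, so only the cut-off errors and `B u` survive. -/
theorem massiveDirac_sub_eq {m κ l : ℝ} {w : Spinor}
    (hw : Matrix.toEuclideanCLM (𝕜 := ℂ) ((κ : ℂ) • alpha 2 + (m : ℂ) • beta) w = (l : ℂ) • w)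
    {B : SpinorL2 →L[ℂ] SpinorL2} {u : sobolevH1}
    (hu : ∀ᵐ x, ∃ c : ℂ, (u : SpinorL2) x = c • w) :
    massiveDirac m B u - (l : ℂ) • (u : SpinorL2) = ∑ j : Fin 3, (-Complex.I) • matrixL2 (alpha j)
      (weakDeriv j u - (if j = 2 then κ * Complex.I else 0) • (u : SpinorL2)) - B u := by
  have hM : Matrix.toEuclideanCLM (𝕜 := ℂ)
      ((κ : ℂ) • alpha 2 + (m : ℂ) • beta + (-l : ℂ) • 1) w = 0 := by
    rw [map_add, _root_.add_apply, hw, map_smul, map_one]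
    simp
  have h := matrixL2_eq_zero hM hu
  rw [matrixL2_add, matrixL2_add, matrixL2_smul, matrixL2_smul, matrixL2_smul, matrixL2_one] at h
  have hsum : ∑ j : Fin 3, (-Complex.I) • matrixL2 (alpha j)
      ((if j = 2 then κ * Complex.I else 0) • (u : SpinorL2)) =
      (κ : ℂ) • matrixL2 (alpha 2) (u : SpinorL2) := by
    rw [Finset.sum_eq_single 2]
    · rw [if_pos rfl, map_smul, smul_smul]
      congr 1
      linear_combination (-κ : ℂ) * Complex.I_mul_I
    · intro j _ hj
      rw [if_neg hj, zero_smul, map_zero, smul_zero]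
    · simp
  simp only [map_sub, smul_sub, Finset.sum_sub_distrib]
  rw [hsum, massiveDirac_apply, masslessDirac_apply, alphaD_apply]
  rw [neg_smul] at h
  have h' : (κ : ℂ) • matrixL2 (alpha 2) (u : SpinorL2) =
      (l : ℂ) • (u : SpinorL2) - (m : ℂ) • matrixL2 beta u := by
    rw [eq_sub_iff_add_eq, ← sub_eq_zero, sub_eq_add_neg]
    exact h
  rw [h']
  abel

/-- The wave packets far away from the origin are approximate eigenfunctions. -/
theorem exists_approx_eigenfunction {m l : ℝ} (hm : m ≠ 0) (hl : m ^ 2 ≤ l ^ 2)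
    {A : Space → Space} (hA : ∀ j : Fin 3, Tendsto (fun x ↦ A x j) (cocompact Space) (𝓝 0))
    {B : SpinorL2 →L[ℂ] SpinorL2} (hB : ∀ u, B u =ᵐ[volume] alphaDotMul A u)
    {ε : ℝ} (hε : 0 < ε) : ∃ u : sobolevH1, (u : SpinorL2) ≠ 0 ∧
      ‖massiveDirac m B u - (l : ℂ) • (u : SpinorL2)‖ ≤ ε * ‖(u : SpinorL2)‖ := by
  obtain ⟨κ, w, hw0, hw⟩ := exists_planeWave_spinor hm hl
  obtain ⟨C, hC⟩ := exists_wavePacket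
  set a : ℝ := ∑ j : Fin 3, ‖matrixL2 (alpha j)‖ with ha
  have ha0 : 0 ≤ a := Finset.sum_nonneg fun _ _ ↦ norm_nonneg _
  -- Makes the total cut-off error `a C / R` at most `ε/2`; the `+ 1` keeps `R` positive.
  set R : ℝ := 2 * (a * |C| + 1) / ε with hR
  have hR0 : 0 < R := by positivity
  have hsmall : a * (C / R) ≤ ε / 2 := by
    rw [← mul_div_assoc, div_le_iff₀ hR0, hR]
    have : ε / 2 * (2 * (a * |C| + 1) / ε) = a * |C| + 1 := by field_simp
    rw [this]
    nlinarith [le_abs_self C]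
  obtain ⟨r, hr⟩ := Metric.closedBall_compl_subset_of_mem_cocompact
    ((tendsto_alphaDotBound hA).eventually_le_const (half_pos hε)) (0 : Space)
  -- The ball of radius `2R` about `x₀` misses the ball of radius `r` about `0`, outside which `α·A`
  -- is at most `ε/2`; `r` may be negative, hence `|r|`.
  set x₀ : Space := EuclideanSpace.single 0 (|r| + 1 + 2 * R) with hx₀
  have hx₀norm : ‖x₀‖ = |r| + 1 + 2 * R := by
    rw [hx₀, PiLp.norm_single, Real.norm_of_nonneg (by positivity)]
  have hfar : ∀ x ∈ Metric.closedBall x₀ (2 * R), alphaDotBound A x ≤ ε / 2 := by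
    intro x hx
    apply hr
    rw [Set.mem_compl_iff, mem_closedBall_zero_iff]
    rw [mem_closedBall_iff_norm'] at hx
    have := norm_sub_norm_le x₀ x
    linarith [le_abs_self r]
  obtain ⟨u, hu0, hderiv, hu⟩ := hC κ w hw0 x₀ R hR0
  refine ⟨u, hu0, ?_⟩
  rw [massiveDirac_sub_eq hw (hu.mono fun x hx ↦ hx.1)]
  have hBu : ‖B u‖ ≤ ε / 2 * ‖(u : SpinorL2)‖ := by
    apply Lp.norm_le_mul_norm_of_ae_le_mul
    filter_upwards [hB u, hu] with x h1 ⟨_, h2⟩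
    rw [h1]
    refine (norm_alphaDotMul_le A u x).trans ?_
    by_cases hx : x ∈ Metric.closedBall x₀ (2 * R)
    · gcongr
      exact hfar x hx
    · simp [h2 hx]
  have hsum : ‖∑ j : Fin 3, (-Complex.I) • matrixL2 (alpha j)
      (weakDeriv j u - (if j = 2 then κ * Complex.I else 0) • (u : SpinorL2))‖ ≤
      a * (C / R * ‖(u : SpinorL2)‖) := by
    rw [ha, Finset.sum_mul]
    refine norm_sum_le_of_le _ fun j _ ↦ ?_
    rw [norm_smul, norm_neg, Complex.norm_I, one_mul]
    exact ((matrixL2 (alpha j)).le_opNorm _).trans (by gcongr; exact hderiv j)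
  calc _ ≤ a * (C / R * ‖(u : SpinorL2)‖) + ε / 2 * ‖(u : SpinorL2)‖ :=
        (norm_sub_le _ _).trans (add_le_add hsum hBu)
    _ = a * (C / R) * ‖(u : SpinorL2)‖ + ε / 2 * ‖(u : SpinorL2)‖ := by ring
    _ ≤ ε / 2 * ‖(u : SpinorL2)‖ + ε / 2 * ‖(u : SpinorL2)‖ := by gcongr
    _ = _ := by ring

theorem spectrum_diracOperator {m : ℝ} (hm : 0 < m) {A : Space → Space}
    (hcont : ∀ j : Fin 3, Continuous (fun x ↦ A x j))
    (hA : ∀ j : Fin 3, Tendsto (fun x ↦ A x j) (cocompact Space) (𝓝 0)) :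
    LinearPMap.spectrum (diracOperator m A) = Complex.ofReal '' (Set.Iic (-m) ∪ Set.Ici m) := by
  obtain ⟨C, hC⟩ := exists_alphaDotBound_le hcont hA
  obtain ⟨B, hB⟩ := exists_bounded_alphaDotMul hcont hC
  rw [diracOperator_eq m hB]
  ext z
  constructor
  · intro hz
    by_contra hz'
    -- `HasBoundedInverse` of `massiveDirac m B - z` unfolds to membership of `z` in `resolventSet`.
    refine hz (massiveDirac_hasBoundedInverse m hB fun him ↦ ?_)
    by_contra! hre
    refine hz' ⟨z.re, ?_, Complex.ext rfl him.symm⟩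
    rcases le_abs.mp hre with h | h
    · exact Or.inr h
    · exact Or.inl (le_neg_of_le_neg h)
  · rintro ⟨l, hl, rfl⟩
    have hl' : m ^ 2 ≤ l ^ 2 := by
      rcases hl with h | h
      · rw [Set.mem_Iic] at h
        nlinarith
      · rw [Set.mem_Ici] at h
        nlinarith
    exact LinearPMap.notMem_resolventSet_of_approx fun ε hε ↦
      exists_approx_eigenfunction hm.ne' hl' hA hB hε

end

end MagneticDirac

/-! ### Conclusion. -/

theorem mainTheorem12 (m : ℝ) (hm : 0 < m)
    (A : MagneticDirac.Space → MagneticDirac.Space)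
    (hcont : ∀ j : Fin 3, Continuous (fun x ↦ A x j))
    (hdecay : ∀ j : Fin 3,
      (fun x ↦ A x j) =o[cocompact MagneticDirac.Space] (fun x ↦ ‖x‖⁻¹)) :
    LinearPMap.spectrum (MagneticDirac.diracOperator m A) =
        LinearPMap.essentialSpectrum (MagneticDirac.diracOperator m A) ∧
      LinearPMap.essentialSpectrum (MagneticDirac.diracOperator m A) =
        Complex.ofReal '' (Set.Iic (-m) ∪ Set.Ici m) := by
  have hA : ∀ j : Fin 3,
      Tendsto (fun x ↦ A x j) (cocompact MagneticDirac.Space) (nhds 0) := fun j ↦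
    (hdecay j).isBigO.trans_tendsto
      (tendsto_inv_atTop_zero.comp (tendsto_norm_cocompact_atTop (E := MagneticDirac.Space)))
  have hspec := MagneticDirac.spectrum_diracOperator hm hcont hA
  have hess : LinearPMap.essentialSpectrum (MagneticDirac.diracOperator m A) =
      LinearPMap.spectrum (MagneticDirac.diracOperator m A) := by
    apply LinearPMap.essentialSpectrum_eq_spectrum_of_no_isolated
    rw [hspec]
    rintro _ ⟨l, hl, rfl⟩ ε hε
    -- Moving away from the gap by `ε/2` stays in the same half-line, so no point is isolated.
    rcases hl with h | h
    · rw [Set.mem_Iic] at h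
      refine ⟨_, ⟨l - ε / 2, Or.inl (Set.mem_Iic.mpr (by linarith)), rfl⟩, ?_, ?_⟩
      · rw [Complex.isometry_ofReal.dist_eq, Real.dist_eq, abs_lt]
        constructor <;> linarith
      · simp [hε.ne']
    · rw [Set.mem_Ici] at h
      refine ⟨_, ⟨l + ε / 2, Or.inr (Set.mem_Ici.mpr (by linarith)), rfl⟩, ?_, ?_⟩
      · rw [Complex.isometry_ofReal.dist_eq, Real.dist_eq, abs_lt]
        constructor <;> linarith
      · simp [hε.ne']
  exact ⟨hess.symm, hess.trans hspec⟩
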